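/- **Setting.** Graphs are finite and have at most one edge between two vertices. An *MVR chain graph* has only directed ($\to$) and bidirected ($\leftrightarrow$) edges and no partially directed cycle, i.e. no distinct $v_1,\dots,v_n$ ($n\ge 3$, $v_{n+1}=v_1$) with $v_i\to v_{i+1}$ or $v_i\leftrightarrow v_{i+1}$ for all $i$ and $v_j\to v_{j+1}$ for some $j$. A chain is a sequence of distinct, consecutively adjacent vertices; an inner vertex is a collider if both neighbouring edges of the chain have an arrowhead at it. A chain between $a,b\notin Z$ is $m$-connecting given $Z$ if no noncollider on it is in $Z$ and every collider on it is in $Z$ or an ancestor (along directed edges) of a vertex of $Z$. For disjoint $X,Y,Z$ with $X,Y\neq\emptyset$, the sets $X,Y$ are $m$-separated given $Z$ if no chain between $X$ and $Y$ is $m$-connecting given $Z$. Two MVR chain graphs on the same vertices are *Markov equivalent* if they have the same $m$-separations. A joint distribution $p$ of random variables indexed by $V$ (with values in standard Borel spaces) is *faithful* to $G$ if for all such $X,Y,Z\subseteq V$: $X\perp\!\!\!\perp_p Y\mid Z$ if and only if $X$ and $Y$ are $m$-separated given $Z$ in $G$. **The stable PC-like algorithm** uses answers to queries "$u\perp\!\!\!\perp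 v\mid S$?" for $u\ne v$ in $V$ and $S\subseteq V\setminus\{u,v\}$. 1. *Skeleton.* Let $H$ be the complete undirected graph on $V$. For $i=0,1,\dots,|V|-2$: store the adjacency sets $a_H(v)$ of all $v\in V$ in the current $H$; then, while possible, select $u,v$ adjacent in $H$ and $S\subseteq a_H(u)\setminus\{v\}$ with $|S|=i$ and $u\perp\!\!\!\perp v\mid S$, record $S_{uv}=S_{vu}=S$, and remove the edge $uv$ from $H$ (the stored sets stay unchanged during level $i$). 2. *$v$-structures.* For every recorded $S_{uv}$ and every $w\notin S_{uv}$ adjacent to both $u$ and $v$ in the skeleton $H$, put arrowheads at $w$ on the edges $uw$ and $vw$. 3. *Rules.* While one of the following puts a new arrowhead, apply it (the ends of edges that are not mentioned are arbitrary). (R1) If there is an arrowhead at $a$ on $ua$, $a,b$ are adjacent with no arrowhead at $a$ on $ab$, $u,b$ are distinct and nonadjacent, and $a\in S_{ub}$, put an arrowhead at $b$ on $ab$. (R2) If there are arrowheads at $u$ on $au$ and at $b$ on $ub$, and $a,b$ are adjacent, put an arrowhead at $b$ on $ab$. (R3) If there are arrowheads at $b$ on $ub$ and on $vb$, $u,v$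 are distinct and nonadjacent, $a$ is adjacent to $u,v,b$, and $a\in S_{uv}$, put an arrowhead at $b$ on $ab$. 4. *Orientation of the rest.* An edge is now undirected, directed or bidirected if it has zero, one or two arrowheads. Take a junction tree of the graph formed by all vertices and the undirected edges (a tree on its maximal cliques in which $C\cap D$ is contained in every clique on the path between $C$ and $D$), a root of it, a total order of the cliques in which cliques closer to the root come first, and a total order of the vertices in which a vertex whose first clique is earlier comes earlier. Orient every undirected edge from its earlier to its later end, and output the resulting graph. All choices left open (pairs, sets $S$, rules, tree, root, orders) may be made arbitrarily, e.g. by means of an ordering of $V$. **Theorem.** Let $V$ be finite, let the distribution $p$ of the variables $V$ be faithful to an MVR chain graph $G$, and let the conditional independence information be perfect: for all $u\ne v$ in $V$ and $S\subseteq V\setminus\{u,v\}$ the query is answered positively if and only if $u\perp\!\!\!\perp_p v\mid S$. Then, whatever choices are made, the stable PC-like algorithm terminates, never gets stuck (in particular the junction tree in step 4 exists), and outputs an MVR chain graph $G'$ that is Markov equivalent to $G$ and has exactly the minimum set of bidirected edges for its Markov equivalence class: every bidirected edge of $G'$ is a bidirected edge of every MVR chain graph that is Markov equivalent to $G$. 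-/

import Mathlib

open MeasureTheory ProbabilityTheory

/-- A simple mixed graph: an undirected skeleton in which every end of every edge may carry an
arrowhead. `head a b` means that `a` and `b` are adjacent and that the edge between them has an
arrowhead at `b`. An edge is undirected, directed or bidirected according to whether it carries
zero, one or two arrowheads. -/
structure MixedGraph (V : Type*) where
  skel : SimpleGraph V
  head : V → V → Prop
  adj_of_head : ∀ a b, head a b → skel.Adj a b

namespace MixedGraph

variable {V : Type*}

/-- The directed edge `a → b`. -/
def Dir (G : MixedGraph V) (a b : V) : Prop := G.head a b ∧ ¬ G.head b a

/-- The bidirected edge `a ↔ b`. -/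
def Bi (G : MixedGraph V) (a b : V) : Prop := G.head a b ∧ G.head b a

/-- The undirected edge `a - b`. -/
def Und (G : MixedGraph V) (a b : V) : Prop := G.skel.Adj a b ∧ ¬ G.head a b ∧ ¬ G.head b a

/-- `v 0, …, v (n - 1), v n = v 0` is a partially directed cycle. -/
def IsPartiallyDirectedCycle (G : MixedGraph V) (n : ℕ) (v : ℕ → V) : Prop :=
  3 ≤ n ∧ Set.InjOn v (Set.Iio n) ∧ v n = v 0 ∧
    (∀ i < n, G.Bi (v i) (v (i + 1)) ∨ G.Dir (v i) (v (i + 1))) ∧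
    ∃ i < n, G.Dir (v i) (v (i + 1))

/-- Multivariate regression (MVR) chain graph: only directed and bidirected edges, and no
partially directed cycle (in particular no directed cycle). -/
def IsMVRChainGraph (G : MixedGraph V) : Prop :=
  (∀ a b, ¬ G.Und a b) ∧ ∀ n v, ¬ G.IsPartiallyDirectedCycle n v

/-- `An(Z)`: the vertices of `Z` and their ancestors. -/
def An (G : MixedGraph V) (Z : Finset V) : Set V :=
  {x | ∃ z ∈ Z, Relation.ReflTransGen G.Dir x z}

/-- The `i`-th vertex of a chain is a collider: both neighbouring edges of the chain have an
arrowhead at it (used only for `0 < i < length`). -/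
def IsColliderAt (G : MixedGraph V) {a b : V} (c : G.skel.Walk a b) (i : ℕ) : Prop :=
  G.head (c.getVert (i - 1)) (c.getVert i) ∧ G.head (c.getVert (i + 1)) (c.getVert i)

/-- A chain (a sequence of distinct vertices, consecutive ones being adjacent) is `m`-connecting
given `Z`. -/
def IsMConnecting (G : MixedGraph V) {a b : V} (c : G.skel.Walk a b) (Z : Finset V) : Prop :=
  c.IsPath ∧ a ∉ Z ∧ b ∉ Z ∧ ∀ i, 0 < i → i < c.length →
    (G.IsColliderAt c i → c.getVert i ∈ G.An Z) ∧ (¬ G.IsColliderAt c i → c.getVert i ∉ Z)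

/-- `X` and `Y` are `m`-separated given `Z` (for disjoint `X`, `Y`, `Z`). -/
def MSep (G : MixedGraph V) (X Y Z : Finset V) : Prop :=
  ∀ a ∈ X, ∀ b ∈ Y, ∀ c : G.skel.Walk a b, ¬ G.IsMConnecting c Z

end MixedGraph

/-- The triples of finite sets for which independence statements are made. -/
def AdmissibleTriple {V : Type*} (X Y Z : Finset V) : Prop :=
  X.Nonempty ∧ Y.Nonempty ∧ Disjoint X Y ∧ Disjoint X Z ∧ Disjoint Y Z

namespace MixedGraph

variable {V : Type*}

/-- The independence model given by `m`-separation. -/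
def indepModel (G : MixedGraph V) : Set (Finset V × Finset V × Finset V) :=
  {t | AdmissibleTriple t.1 t.2.1 t.2.2 ∧ G.MSep t.1 t.2.1 t.2.2}

def MarkovEquivalent (G H : MixedGraph V) : Prop := G.indepModel = H.indepModel

end MixedGraph

section Distribution

variable {V : Type*} [Fintype V] {E : V → Type*} [∀ v, MeasurableSpace (E v)]
  [∀ v, StandardBorelSpace (E v)]

/-- `X ⫫ Y | Z` in the joint distribution `p` of the variables indexed by `V`. -/
def CondIndepVars (p : Measure (∀ v, E v)) [IsFiniteMeasure p] (X Y Z : Finset V) : Prop :=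
  CondIndepFun (MeasurableSpace.comap (Z.restrict (π := E)) inferInstance)
    (Finset.measurable_restrict Z).comap_le (X.restrict (π := E)) (Y.restrict (π := E)) p

/-- `p` is faithful to `G`: the conditional independences in `p` are exactly the
`m`-separations in `G`. -/
def IsFaithful (p : Measure (∀ v, E v)) [IsFiniteMeasure p] (G : MixedGraph V) : Prop :=
  ∀ X Y Z : Finset V, AdmissibleTriple X Y Z → (CondIndepVars p X Y Z ↔ G.MSep X Y Z)

end Distribution

namespace StablePC

variable {V : Type*}

open Classical in
/-- Record `T` as `S_uv = S_vu`. -/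
noncomputable def setSep (S : V → V → Option (Finset V)) (u v : V) (T : Finset V) :
    V → V → Option (Finset V) :=
  fun x y => if (x = u ∧ y = v) ∨ (x = v ∧ y = u) then some T else S x y

/-- At level `i`, with stored adjacencies `A` and current graph `H`, the pair `(u, v)` can be
selected and its edge removed because of the set `T`. (The requirement that `u` has at least `i`
stored neighbours besides `v` follows from the existence of `T`.) -/
def CanRemove (test : V → V → Finset V → Prop) (i : ℕ) (A H : SimpleGraph V) (u v : V)
    (T : Finset V) : Prop :=
  H.Adj u v ∧ A.Adj u v ∧ (∀ x ∈ T, A.Adj u x ∧ x ≠ v) ∧ T.card = i ∧ test u v T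

/-- The graph after `v`-structure recovery: for every recorded separator `S_uv` and all
`u - w - v` in the skeleton with `w ∉ S_uv`, arrowheads at `w` are put on both edges. -/
def vStructures (H : SimpleGraph V) (S : V → V → Option (Finset V)) : MixedGraph V where
  skel := H
  head u w := H.Adj u w ∧ ∃ v T, H.Adj w v ∧ S u v = some T ∧ w ∉ T
  adj_of_head _ _ h := h.1

/-- Put an arrowhead at `b` on the edge between `a` and `b`. -/
def addHead (M : MixedGraph V) (a b : V) (h : M.skel.Adj a b) : MixedGraph V where
  skel := M.skel
  head x y := M.head x y ∨ (x = a ∧ y = b)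
  adj_of_head := by
    rintro x y (hxy | ⟨rfl, rfl⟩)
    · exact M.adj_of_head x y hxy
    · exact h

/-- One of the orientation rules 1-3 puts an arrowhead at `b` on the edge between `a` and `b`.
Ends of edges that are not mentioned are arbitrary.
Rule 1: `u → a` or `u ↔ a`, `a` and `b` adjacent without arrowhead at `a`, `u` and `b` not
adjacent, `a ∈ S_ub`.
Rule 2: there are arrowheads at `u` on `a, u` and at `b` on `u, b`, and `a`, `b` are adjacent.
Rule 3: there are arrowheads at `b` on `u, b` and `v, b`, where `u` and `v` are not adjacent, `a`
is adjacent to `u`, `v` and `b`, and `a ∈ S_uv`. -/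
inductive RuleApplies (S : V → V → Option (Finset V)) (M : MixedGraph V) : V → V → Prop
  | rule1 (u a b : V) (T : Finset V) : M.head u a → M.skel.Adj a b → ¬ M.head b a → u ≠ b →
      ¬ M.skel.Adj u b → S u b = some T → a ∈ T → RuleApplies S M a b
  | rule2 (a u b : V) : M.head a u → M.head u b → M.skel.Adj a b → RuleApplies S M a b
  | rule3 (u v a b : V) (T : Finset V) : M.head u b → M.head v b → u ≠ v → ¬ M.skel.Adj u v →
      M.skel.Adj a u → M.skel.Adj a v → M.skel.Adj a b → S u v = some T → a ∈ T →
      RuleApplies S M a b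

theorem RuleApplies.adj {S : V → V → Option (Finset V)} {M : MixedGraph V} {a b : V}
    (h : RuleApplies S M a b) : M.skel.Adj a b := by
  cases h <;> assumption

/-- The undirected subgraph (all vertices, only the undirected edges). -/
def undPart (M : MixedGraph V) : SimpleGraph V where
  Adj := M.Und
  symm := ⟨fun _ _ h => ⟨h.1.symm, h.2.2, h.2.1⟩⟩
  loopless := ⟨fun _ h => M.skel.irrefl h.1⟩

/-- The cliques, i.e. the maximal complete vertex sets. -/
abbrev Clique (U : SimpleGraph V) : Type _ :=
  {C : Set V // Maximal U.IsClique C}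

/-- A junction tree of `U`: a tree on the cliques such that `C ∩ D` is contained in every clique on
the tree path between `C` and `D`. -/
def IsJunctionTree (U : SimpleGraph V) (T : SimpleGraph (Clique U)) : Prop :=
  T.IsTree ∧ ∀ (C D : Clique U) (w : T.Walk C D), w.IsPath →
    ∀ K ∈ w.support, C.1 ∩ D.1 ⊆ K.1

/-- `rank` is a total order of the cliques which starts at the root and in which a clique that is
closer to the root comes earlier. -/
def IsCliqueOrder {U : SimpleGraph V} (T : SimpleGraph (Clique U)) (root : Clique U)
    (rank : Clique U → ℕ) : Prop :=
  Function.Injective rank ∧ ∀ C D, T.dist root C < T.dist root D → rank C < rank D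

/-- `pos` is a total order of the vertices compatible with the order of the cliques: a vertex whose
first clique is earlier comes earlier. -/
def IsNodeOrder {U : SimpleGraph V} (rank : Clique U → ℕ) (pos : V → ℕ) : Prop :=
  Function.Injective pos ∧ ∀ a b, (∃ C : Clique U, a ∈ C.1 ∧
    ∀ D : Clique U, b ∈ D.1 → rank C < rank D) → pos a < pos b

/-- Orient the undirected edges according to the order `pos`. -/
def orientUnd (M : MixedGraph V) (pos : V → ℕ) : MixedGraph V where
  skel := M.skel
  head a b := M.head a b ∨ (M.Und a b ∧ pos a < pos b)
  adj_of_head := by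
    rintro a b (h | h)
    · exact M.adj_of_head a b h
    · exact h.1.1

/-- The states of the algorithm. -/
inductive State (V : Type*) where
  /-- Skeleton recovery at level `i`: `A` holds the stored adjacency sets, `H` is the current
  graph and `S` the separators recorded so far. -/
  | skeleton (i : ℕ) (A H : SimpleGraph V) (S : V → V → Option (Finset V))
  /-- Application of the orientation rules to the current mixed graph `M`. -/
  | orient (S : V → V → Option (Finset V)) (M : MixedGraph V)
  /-- The algorithm has returned `G`. -/
  | done (G : MixedGraph V)

/-- The complete graph, at level `0`, with no separators recorded. -/
def init : State V := .skeleton 0 ⊤ ⊤ (fun _ _ => none)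

/-- The steps of the stable PC-like algorithm, where `test u v T` is the answer to the query
whether `u ⫫ v | T`. All choices that the algorithm leaves to the order of the variables (pairs,
separating sets, rules, junction tree and the orders derived from it) are nondeterministic, so that
every order is covered. The levels of the skeleton recovery are `i = 0, …, |V| - 2`. -/
inductive Step [Fintype V] (test : V → V → Finset V → Prop) : State V → State V → Prop
  | remove (i : ℕ) (A H : SimpleGraph V) (S : V → V → Option (Finset V)) (u v : V)
      (T : Finset V) : i + 2 ≤ Fintype.card V → CanRemove test i A H u v T →
      Step test (.skeleton i A H S) (.skeleton i A (H.deleteEdges {s(u, v)}) (setSep S u v T))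
  | nextLevel (i : ℕ) (A H : SimpleGraph V) (S : V → V → Option (Finset V)) :
      i + 2 ≤ Fintype.card V → (∀ u v T, ¬ CanRemove test i A H u v T) →
      Step test (.skeleton i A H S) (.skeleton (i + 1) H H S)
  | vStructure (i : ℕ) (A H : SimpleGraph V) (S : V → V → Option (Finset V)) :
      ¬ i + 2 ≤ Fintype.card V →
      Step test (.skeleton i A H S) (.orient S (vStructures H S))
  | rule (S : V → V → Option (Finset V)) (M : MixedGraph V) (a b : V)
      (h : RuleApplies S M a b) : ¬ M.head a b →
      Step test (.orient S M) (.orient S (addHead M a b h.adj))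
  | finish (S : V → V → Option (Finset V)) (M : MixedGraph V)
      (T : SimpleGraph (Clique (undPart M))) (root : Clique (undPart M))
      (rank : Clique (undPart M) → ℕ) (pos : V → ℕ) :
      (∀ a b, RuleApplies S M a b → M.head a b) → IsJunctionTree (undPart M) T →
      IsCliqueOrder T root rank → IsNodeOrder rank pos →
      Step test (.orient S M) (.done (orientUnd M pos))

end StablePC

/-! Call a walk an arrowhead walk if each of its edges has an arrowhead at its later vertex. A mixed
graph without undirected edges is an MVR chain graph iff no arrowhead walk leads from the head of a
directed edge back to its tail.

Skeleton. Of two nonadjacent vertices of `G` at least one is not reachable from the other by an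
arrowhead walk using a directed edge; the parents of the latter then separate the two
(`IsMVRChainGraph.mSep_parents`). No edge of `G` is ever removed and true neighbours stay in the
stored sets, so every nonadjacent pair is separated before the levels end, and Markov equivalent
graphs have equal skeletons.

Arrowheads. A recorded separator contains the middle vertex of an unshielded triple iff that vertex
is not a collider. Hence every arrowhead produced by the v-structures and the rules (`Forced`)
occurs in every MVR chain graph equivalent to `G` (`Forced.head`). Saturation yields a graph `M`
with exactly these arrowheads, whatever the order of the rules. Step 4 creates no bidirected edge,
which gives minimality.

Undirected part. Arrowheads of `M` propagate along undirected edges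
(`IsEssential.head_of_head_und`), so undirected components can be oriented independently of the
rest. Any vertex set has a vertex without proper descendants in it with respect to `G`; its
undirected neighbours there form a clique, since otherwise it would be an unshielded collider of
`G`. This elimination order yields a junction tree, and conversely every order derived from a
junction tree is perfect (`IsNodeOrder.adj`). So step 4 creates no unshielded collider and no
partially directed cycle.

Equivalence. The output and `G` share skeleton and unshielded colliders, which suffices
(`SameColliders.markovEquivalent`): a shortest open walk, chosen with its colliders as near to `Z`
as possible, is open in the other graph too. -/

/-! ### Partially directed cycles as reachability along arrowheads -/

open Relation in
theorem Relation.ReflTransGen.exists_injOn {α : Type*} {r : α → α → Prop} {a b : α}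
    (h : ReflTransGen r a b) :
    ∃ (n : ℕ) (f : ℕ → α), f 0 = a ∧ f n = b ∧ (∀ i < n, r (f i) (f (i + 1))) ∧
      Set.InjOn f (Set.Iic n) := by
  induction h using ReflTransGen.head_induction_on with
  | refl =>
    refine ⟨0, fun _ => b, rfl, rfl, by simp, ?_⟩
    intro i hi j hj _
    simp at hi hj
    omega
  | @head x y hxy _ ih =>
    obtain ⟨n, f, h0, hn, hr, hinj⟩ := ih
    -- If the new first vertex already occurs, everything before its occurrence is dropped.
    by_cases hx : ∃ j ≤ n, f j = x
    · obtain ⟨j, hj, hjx⟩ := hx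
      refine ⟨n - j, fun k => f (j + k), by simpa using hjx, by simp [hj, hn], ?_, ?_⟩
      · intro i hi
        exact hr (j + i) (by omega)
      · intro i hi k hk hik
        simp only [Set.mem_Iic] at hi hk
        have := hinj (x₁ := j + i) (x₂ := j + k) (by simp; omega) (by simp; omega) hik
        omega
    · push Not at hx
      refine ⟨n + 1, fun k => Nat.casesOn k x f, rfl, by simpa using hn, ?_, ?_⟩
      · rintro (_ | i) hi
        · simpa [h0] using hxy
        · exact hr i (by omega)
      · rintro (_ | i) hi (_ | k) hk hik
        · rfl
        · exact absurd hik.symm (hx k (by simpa using hk))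
        · exact absurd hik (hx i (by simpa using hi))
        · have := hinj (x₁ := i) (x₂ := k) (by simpa using hi) (by simpa using hk) hik
          omega

theorem Relation.ReflTransGen.of_seq {α : Type*} {r : α → α → Prop} {f : ℕ → α} {i j : ℕ}
    (hij : i ≤ j) (h : ∀ k, i ≤ k → k < j → r (f k) (f (k + 1))) :
    Relation.ReflTransGen r (f i) (f j) := by
  induction j, hij using Nat.le_induction with
  | base => exact .refl
  | succ j hij ih => exact (ih fun k h1 h2 => h k h1 (by omega)).tail (h j hij (by omega))

namespace MixedGraph

open Relation

variable {V : Type*} {G : MixedGraph V}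

theorem not_head_self (a : V) : ¬ G.head a a := fun h => G.skel.irrefl (G.adj_of_head a a h)

/-- A walk back from `b` to `a` can be made repetition-free and closed by `a → b`. It has at least
two edges, as `a → b` is neither a loop nor bidirected, so the cycle has length at least 3. -/
theorem IsMVRChainGraph.not_reflTransGen_of_dir (hG : G.IsMVRChainGraph) {a b : V}
    (hab : G.Dir a b) : ¬ ReflTransGen G.head b a := by
  intro h
  obtain ⟨n, f, h0, hn, hr, hinj⟩ := h.exists_injOn
  have hne : 2 ≤ n := by
    by_contra! hlt
    interval_cases n
    · exact not_head_self a (by rw [← h0, hn] at hab; exact hab.1)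
    · have := hr 0 (by omega)
      rw [h0, hn] at this
      exact hab.2 this
  refine hG.2 (n + 1) (fun i => if i ≤ n then f i else b) ⟨by omega, ?_, by simp [h0], ?_, ?_⟩
  · intro i hi j hj hij
    simp only [Set.mem_Iio] at hi hj
    simp only [show i ≤ n by omega, show j ≤ n by omega, if_true] at hij
    exact hinj (by simp; omega) (by simp; omega) hij
  · intro i hi
    rcases Nat.lt_or_ge i n with hin | hin
    · have := hr i hin
      simp only [show i ≤ n by omega, show i + 1 ≤ n by omega, if_true]
      unfold Bi Dir
      tauto
    · obtain rfl : i = n := by omega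
      simp [hn, hab]
  · exact ⟨n, by omega, by simp [hn, hab]⟩

theorem isMVRChainGraph_of_not_reflTransGen (hU : ∀ a b, ¬ G.Und a b)
    (h : ∀ a b, G.Dir a b → ¬ ReflTransGen G.head b a) : G.IsMVRChainGraph := by
  refine ⟨hU, ?_⟩
  rintro n v ⟨-, -, hn, hr, i, hi, hd⟩
  have hr' : ∀ i < n, G.head (v i) (v (i + 1)) := fun i hi => by
    rcases hr i hi with h | h <;> exact h.1
  refine h _ _ hd ?_
  have h1 : ReflTransGen G.head (v (i + 1)) (v n) :=
    .of_seq (by omega) fun k _ hk => hr' k hk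
  have h2 : ReflTransGen G.head (v 0) (v i) :=
    .of_seq (by omega) fun k _ hk => hr' k (by omega)
  rw [hn] at h1
  exact h1.trans h2

theorem IsMVRChainGraph.dir_of_not_head (hG : G.IsMVRChainGraph) {a b : V}
    (hab : G.skel.Adj a b) (h : ¬ G.head b a) : G.Dir a b :=
  ⟨by_contra fun h' => hG.1 a b ⟨hab, h', h⟩, h⟩

/-- Otherwise `z → x` would close a partially directed cycle. This is the soundness of rule 2 and,
with its two directed variants below, the main tool for shielded triples. -/
theorem IsMVRChainGraph.head_trans (hG : G.IsMVRChainGraph) {x y z : V} (hxy : G.head x y)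
    (hyz : G.head y z) (hxz : G.skel.Adj x z) : G.head x z := by
  by_contra h
  exact hG.not_reflTransGen_of_dir (hG.dir_of_not_head hxz.symm h)
    ((ReflTransGen.single hxy).tail hyz)

theorem IsMVRChainGraph.dir_of_dir_head (hG : G.IsMVRChainGraph) {x y z : V} (hxy : G.Dir x y)
    (hyz : G.head y z) (hxz : G.skel.Adj x z) : G.Dir x z :=
  hG.dir_of_not_head hxz fun h =>
    hG.not_reflTransGen_of_dir hxy ((ReflTransGen.single hyz).tail h)

theorem IsMVRChainGraph.dir_of_head_dir (hG : G.IsMVRChainGraph) {x y z : V} (hxy : G.head x y)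
    (hyz : G.Dir y z) (hxz : G.skel.Adj x z) : G.Dir x z :=
  hG.dir_of_not_head hxz fun h =>
    hG.not_reflTransGen_of_dir hyz ((ReflTransGen.single h).tail hxy)

theorem reflTransGen_head_of_dir {a b : V} (h : ReflTransGen G.Dir a b) :
    ReflTransGen G.head a b :=
  ReflTransGen.mono (fun _ _ h => h.1) _ _ h

theorem mem_An_of_mem {Z : Finset V} {x : V} (h : x ∈ Z) : x ∈ G.An Z := ⟨x, h, .refl⟩

theorem mem_An_of_dir {Z : Finset V} {x y : V} (h : G.Dir x y) (hy : y ∈ G.An Z) :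
    x ∈ G.An Z := by
  obtain ⟨z, hz, hyz⟩ := hy
  exact ⟨z, hz, hyz.head h⟩

end MixedGraph

namespace MixedGraph

/-! ### Open walks and m-connecting chains -/

open Relation

variable {V : Type*} {G : MixedGraph V} {Z : Finset V}

/-- The triple `x, w, y` of consecutive vertices does not block a walk given `Z`. -/
def Open (G : MixedGraph V) (Z : Finset V) (x w y : V) : Prop :=
  (G.head x w ∧ G.head y w → w ∈ G.An Z) ∧ (¬ (G.head x w ∧ G.head y w) → w ∉ Z)

/-- `v 0, …, v n` is a walk, possibly with repetitions, whose inner vertices are all open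
given `Z`. -/
structure OpenWalk (G : MixedGraph V) (Z : Finset V) (n : ℕ) (v : ℕ → V) : Prop where
  adj : ∀ i < n, G.skel.Adj (v i) (v (i + 1))
  opn : ∀ i, i + 1 < n → G.Open Z (v i) (v (i + 1)) (v (i + 2))

theorem Open.symm {x w y : V} (h : G.Open Z x w y) : G.Open Z y w x := by
  unfold Open at *
  tauto

theorem Open.of_head {p x w y : V} (h : G.Open Z p x w) (hw : G.head w x) (hy : G.head y x) :
    G.Open Z p x y := by
  unfold Open at *
  tauto

theorem Open.of_dir {p x w y : V} (h : G.Open Z p x w) (hw : G.Dir x w) (hy : G.Dir x y) :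
    G.Open Z p x y := by
  unfold Open Dir at *
  tauto

theorem Open.of_mem_An {p x w y : V} (h : G.Open Z p x w) (hx : x ∈ G.An Z)
    (hy : G.head y x) : G.Open Z p x y := by
  unfold Open at *
  tauto

/-- If replacing the successor of `x` by a child of `x` blocks, `x` was a collider. -/
theorem Open.head_of_not_open {p x w y : V} (h : G.Open Z p x w) (hy : G.Dir x y)
    (hn : ¬ G.Open Z p x y) : x ∈ Z ∧ G.head p x ∧ G.head w x := by
  unfold Open Dir at *
  tauto

/-- `f 0, …, f l` followed by `g 0, g 1, …`. -/
def joinSeq (l : ℕ) (f g : ℕ → V) (k : ℕ) : V := if k ≤ l then f k else g (k - (l + 1))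

theorem joinSeq_le {l k : ℕ} {f g : ℕ → V} (h : k ≤ l) : joinSeq l f g k = f k := if_pos h

theorem joinSeq_add {l k : ℕ} {f g : ℕ → V} : joinSeq l f g (l + 1 + k) = g k := by
  simp [joinSeq, show ¬ l + 1 + k ≤ l by omega]

theorem OpenWalk.join {l t : ℕ} {f g : ℕ → V} (hf : G.OpenWalk Z l f) (hg : G.OpenWalk Z t g)
    (hadj : G.skel.Adj (f l) (g 0)) (h1 : ∀ k, l = k + 1 → G.Open Z (f k) (f l) (g 0))
    (h2 : 0 < t → G.Open Z (f l) (g 0) (g 1)) :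
    G.OpenWalk Z (l + 1 + t) (joinSeq l f g) := by
  have e0 : joinSeq l f g (l + 1) = g 0 := joinSeq_add (k := 0)
  have e1 : joinSeq l f g (l + 1 + 1) = g 1 := joinSeq_add (k := 1)
  constructor
  · intro i hi
    rcases lt_trichotomy i l with h | rfl | h
    · rw [joinSeq_le h.le, joinSeq_le (by omega)]
      exact hf.adj i h
    · rw [joinSeq_le le_rfl, e0]
      exact hadj
    · obtain ⟨k, rfl⟩ := Nat.exists_eq_add_of_lt h
      rw [show l + k + 1 = l + 1 + k by ring, joinSeq_add,
        show l + 1 + k + 1 = l + 1 + (k + 1) by ring, joinSeq_add]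
      exact hg.adj k (by omega)
  · intro i hi
    rcases lt_trichotomy i l with h | rfl | h
    · rw [joinSeq_le h.le, joinSeq_le (by omega)]
      rcases Nat.lt_or_ge (i + 1) l with h' | h'
      · rw [joinSeq_le (by omega)]
        exact hf.opn i h'
      · obtain rfl : l = i + 1 := by omega
        rw [e0]
        exact h1 i rfl
    · rw [joinSeq_le le_rfl, e0, show i + 2 = i + 1 + 1 by ring, e1]
      exact h2 (by omega)
    · obtain ⟨k, rfl⟩ := Nat.exists_eq_add_of_lt h
      rw [show l + k + 1 = l + 1 + k by ring, joinSeq_add,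
        show l + 1 + k + 1 = l + 1 + (k + 1) by ring, joinSeq_add,
        show l + 1 + k + 2 = l + 1 + (k + 2) by ring, joinSeq_add]
      exact hg.opn k (by omega)

theorem OpenWalk.take {n l : ℕ} {v : ℕ → V} (h : G.OpenWalk Z n v) (hl : l ≤ n) :
    G.OpenWalk Z l v :=
  ⟨fun i hi => h.adj i (by omega), fun i hi => h.opn i (by omega)⟩

theorem OpenWalk.drop {n t r : ℕ} {v : ℕ → V} (h : G.OpenWalk Z n v) (hr : r + t = n) :
    G.OpenWalk Z t (fun k => v (r + k)) :=
  ⟨fun i hi => h.adj (r + i) (by omega), fun i hi => h.opn (r + i) (by omega)⟩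

theorem OpenWalk.single (d : V) : G.OpenWalk Z 0 (fun _ => d) :=
  ⟨fun i hi => by omega, fun i hi => by omega⟩

theorem OpenWalk.rev {n : ℕ} {v : ℕ → V} (h : G.OpenWalk Z n v) :
    G.OpenWalk Z n (fun k => v (n - k)) := by
  constructor
  · intro i hi
    have := (h.adj (n - (i + 1)) (by omega)).symm
    rwa [show n - (i + 1) + 1 = n - i by omega] at this
  · intro i hi
    have := (h.opn (n - (i + 2)) (by omega)).symm
    rwa [show n - (i + 2) + 1 = n - (i + 1) by omega,
      show n - (i + 2) + 2 = n - i by omega] at this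

/-- There is an open walk of length `n` between `a` and `b`. -/
def OpenConn (G : MixedGraph V) (Z : Finset V) (a b : V) (n : ℕ) : Prop :=
  ∃ v, G.OpenWalk Z n v ∧ v 0 = a ∧ v n = b

theorem OpenConn.symm {a b : V} {n : ℕ} (h : G.OpenConn Z a b n) : G.OpenConn Z b a n := by
  obtain ⟨v, hv, rfl, rfl⟩ := h
  exact ⟨_, hv.rev, by simp, by simp⟩

theorem OpenWalk.shortcut {n l r : ℕ} {v : ℕ → V} (h : G.OpenWalk Z n v) (hlr : l < r)
    (hr : r ≤ n) (hadj : G.skel.Adj (v l) (v r))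
    (h1 : ∀ k, l = k + 1 → G.Open Z (v k) (v l) (v r))
    (h2 : r < n → G.Open Z (v l) (v r) (v (r + 1))) :
    G.OpenConn Z (v 0) (v n) (l + 1 + (n - r)) := by
  refine ⟨_, (h.take (show l ≤ n by omega)).join (h.drop (show r + (n - r) = n by omega))
    hadj h1 fun ht => h2 (by omega), ?_, ?_⟩
  · rw [joinSeq_le (by omega)]
  · rw [joinSeq_add]
    congr 1
    omega

theorem OpenWalk.detour {n l r : ℕ} {v : ℕ → V} {d : V} (h : G.OpenWalk Z n v) (hlr : l < r)
    (hr : r ≤ n) (hl : G.skel.Adj (v l) d) (hrd : G.skel.Adj d (v r))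
    (h1 : ∀ k, l = k + 1 → G.Open Z (v k) (v l) d) (hd : G.Open Z (v l) d (v r))
    (h2 : r < n → G.Open Z d (v r) (v (r + 1))) :
    G.OpenConn Z (v 0) (v n) (l + 1 + 1 + (n - r)) := by
  have e : joinSeq l v (fun _ => d) (l + 1) = d := joinSeq_add (k := 0)
  have hp := (h.take (show l ≤ n by omega)).join (t := 0) (.single d) hl h1 (by simp)
  refine ⟨_, hp.join (h.drop (show r + (n - r) = n by omega)) ?_ ?_ ?_, ?_, ?_⟩
  · simpa [e] using hrd
  · rintro k hk
    obtain rfl : k = l := by omega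
    simpa [e, joinSeq_le] using hd
  · intro ht
    simpa [e] using h2 (by omega)
  · rw [joinSeq_le (by omega), joinSeq_le (by omega)]
  · rw [show l + 1 + 1 + (n - r) = l + 1 + 0 + 1 + (n - r) by ring, joinSeq_add]
    congr 1
    omega

/-- The walk leaves `v i` by a directed edge but has no arrowhead at the end of step `j`, so its
initial directed stretch stops in between; it can only stop at a collider, which lies in `An Z`. -/
theorem OpenWalk.mem_An_of_not_head (hG : G.IsMVRChainGraph) {n i j : ℕ} {v : ℕ → V}
    (h : G.OpenWalk Z n v) (hij : i ≤ j) (hj : j < n)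
    (hi : G.Dir (v i) (v (i + 1))) (hd : ¬ G.head (v j) (v (j + 1))) : v i ∈ G.An Z := by
  have key : ∀ m, i ≤ m → m ≤ j →
      v i ∈ G.An Z ∨ (ReflTransGen G.Dir (v i) (v m) ∧ G.Dir (v m) (v (m + 1))) := by
    intro m him
    induction m, him using Nat.le_induction with
    | base => exact fun _ => .inr ⟨.refl, hi⟩
    | succ m him ih =>
      intro hm
      rcases ih (by omega) with h' | ⟨h1, h2⟩
      · exact .inl h'
      · by_cases hh : G.head (v (m + 2)) (v (m + 1))
        · left
          obtain ⟨z, hz, hmz⟩ := (h.opn m (by omega)).1 ⟨h2.1, hh⟩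
          exact ⟨z, hz, (h1.tail h2).trans hmz⟩
        · exact .inr ⟨h1.tail h2, hG.dir_of_not_head (h.adj (m + 1) (by omega)) hh⟩
  rcases key j hij le_rfl with h' | ⟨-, h2⟩
  · exact h'
  · exact absurd h2.1 hd

/-- A shortest open walk has no repeated vertices. -/
theorem OpenWalk.injOn_of_minimal (hG : G.IsMVRChainGraph) {n : ℕ} {v : ℕ → V}
    (h : G.OpenWalk Z n v) (hne : v 0 ≠ v n)
    (hmin : ∀ m < n, ¬ G.OpenConn Z (v 0) (v n) m) : Set.InjOn v (Set.Iic n) := by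
  have key : ∀ i j, i < j → j ≤ n → v i ≠ v j := by
    intro i j hij hj hv
    rcases hj.lt_or_eq with hj | rfl
    · refine hmin _ ?_ (h.shortcut (l := i) (r := j + 1) (by omega) hj ?_ ?_ ?_)
      · omega
      · rw [hv]
        exact h.adj j hj
      · rintro k rfl
        obtain ⟨j, rfl⟩ : ∃ j', j = j' + 1 := ⟨j - 1, by omega⟩
        have hi := h.opn k (by omega)
        have hj' := h.opn j (by omega)
        -- Cutting out the loop joins the first edge at one occurrence to the last edge at the
        -- other. If this creates a collider where neither occurrence was one, the loop starts with
        -- a directed edge and returns without an arrowhead, so `mem_An_of_not_head` applies. A new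
        -- noncollider lacks an arrowhead that one of the two occurrences lacked already.
        refine ⟨fun hh => ?_, fun hh => ?_⟩
        · by_cases c1 : G.head (v (k + 2)) (v (k + 1))
          · exact hi.1 ⟨hh.1, c1⟩
          · by_cases c2 : G.head (v j) (v (j + 1))
            · rw [hv] at hh ⊢
              exact hj'.1 ⟨c2, hh.2⟩
            · exact h.mem_An_of_not_head hG (i := k + 1) (j := j) (by omega) (by omega)
                (hG.dir_of_not_head (h.adj (k + 1) (by omega)) c1) c2
        · by_cases c1 : G.head (v k) (v (k + 1))
          · rw [hv] at hh c1 ⊢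
            exact hj'.2 fun h3 => hh ⟨c1, h3.2⟩
          · exact hi.2 fun h3 => c1 h3.1
      · intro hj2
        rw [hv]
        exact h.opn j hj2
    · rcases Nat.eq_zero_or_pos i with rfl | hi
      · exact hne hv
      · exact hmin i hij ⟨v, h.take hij.le, rfl, hv⟩
  intro i hi j hj hij
  simp only [Set.mem_Iic] at hi hj
  by_contra hne'
  rcases lt_or_gt_of_ne hne' with h' | h'
  · exact key i j h' hj hij
  · exact key j i h' hi hij.symm

theorem exists_walk_of_seq {H : SimpleGraph V} (n : ℕ) (v : ℕ → V)
    (h : ∀ i < n, H.Adj (v i) (v (i + 1))) :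
    ∃ c : H.Walk (v 0) (v n), c.length = n ∧ ∀ i ≤ n, c.getVert i = v i := by
  induction n generalizing v with
  | zero => exact ⟨.nil, rfl, by simp⟩
  | succ n ih =>
    obtain ⟨c, hc, hv⟩ := ih (fun k => v (k + 1)) fun i hi => h (i + 1) (by omega)
    refine ⟨.cons (h 0 (by omega)) c, by simp [hc], ?_⟩
    rintro (_ | i) hi
    · simp
    · simpa using hv i (by omega)

theorem OpenWalk.of_isMConnecting {a b : V} {c : G.skel.Walk a b} (h : G.IsMConnecting c Z) :
    G.OpenWalk Z c.length c.getVert :=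
  ⟨fun _ hi => c.adj_getVert_succ hi, fun i hi => by
    simpa [IsColliderAt, Open] using h.2.2.2 (i + 1) (by omega) hi⟩

theorem OpenWalk.exists_isMConnecting {n : ℕ} {v : ℕ → V} (h : G.OpenWalk Z n v)
    (hinj : Set.InjOn v (Set.Iic n)) (h0 : v 0 ∉ Z) (hn : v n ∉ Z) :
    ∃ c : G.skel.Walk (v 0) (v n), G.IsMConnecting c Z := by
  obtain ⟨c, hc, hv⟩ := exists_walk_of_seq n v h.adj
  refine ⟨c, ?_, h0, hn, ?_⟩
  · rw [← SimpleGraph.Walk.IsPath.getVert_injOn_iff, hc]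
    intro i hi j hj hij
    simp only [Set.mem_ofPred_eq] at hi hj
    rw [hv i hi, hv j hj] at hij
    exact hinj hi hj hij
  · rintro (_ | i) h1 h2
    · omega
    · have := h.opn i (by omega)
      rw [hc] at h2
      simpa [IsColliderAt, hv i (by omega), hv (i + 1) (by omega), hv (i + 1 + 1) (by omega),
        Open] using this

/-- Two vertices are `m`-connected iff there is an open walk between them. -/
theorem mSep_iff (hG : G.IsMVRChainGraph) {a b : V} (hab : a ≠ b) (ha : a ∉ Z) (hb : b ∉ Z) :
    (∃ c : G.skel.Walk a b, G.IsMConnecting c Z) ↔ ∃ n, G.OpenConn Z a b n := by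
  constructor
  · rintro ⟨c, hc⟩
    exact ⟨_, _, .of_isMConnecting hc, by simp, by simp⟩
  · intro h
    classical
    obtain ⟨v, hv, h0, hn⟩ := Nat.find_spec h
    have hmin := fun m hm => Nat.find_min (m := m) h hm
    generalize Nat.find h = n at *
    subst h0 hn
    exact hv.exists_isMConnecting (hv.injOn_of_minimal hG hab hmin) ha hb

end MixedGraph

/-! ### Same skeleton and unshielded colliders imply Markov equivalence -/

namespace MixedGraph

open Relation

variable {V : Type*} {G K : MixedGraph V} {Z : Finset V}

/-- Same skeleton and same unshielded colliders. -/
structure SameColliders (G K : MixedGraph V) : Prop where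
  adj : ∀ a b, G.skel.Adj a b ↔ K.skel.Adj a b
  collider : ∀ x w y, x ≠ y → ¬ G.skel.Adj x y → G.skel.Adj x w → G.skel.Adj w y →
    (G.head x w ∧ G.head y w ↔ K.head x w ∧ K.head y w)

theorem SameColliders.symm (h : G.SameColliders K) : K.SameColliders G :=
  ⟨fun a b => (h.adj a b).symm, fun x w y hxy hn h1 h2 =>
    (h.collider x w y hxy (by rwa [h.adj]) (by rwa [h.adj]) (by rwa [h.adj])).symm⟩

/-- Colliders of `G` on the walk `v` are colliders of `K`. -/
def CollidersTransfer (G K : MixedGraph V) (n : ℕ) (v : ℕ → V) : Prop :=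
  ∀ i, i + 1 < n → G.head (v i) (v (i + 1)) → G.head (v (i + 2)) (v (i + 1)) →
    K.head (v i) (v (i + 1)) ∧ K.head (v (i + 2)) (v (i + 1))

theorem CollidersTransfer.rev {n : ℕ} {v : ℕ → V} (h : CollidersTransfer G K n v) :
    CollidersTransfer G K n (fun k => v (n - k)) := by
  intro i hi h1 h2
  have := h (n - (i + 2)) (by omega)
  rw [show n - (i + 2) + 1 = n - (i + 1) by omega, show n - (i + 2) + 2 = n - i by omega] at this
  exact (this h2 h1).symm

theorem SameColliders.dir_of_unshielded (hK : K.IsMVRChainGraph) (hs : G.SameColliders K)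
    {x w t : V} (hx : G.head x w) (ht : G.Dir w t) (hn : ¬ G.skel.Adj x t)
    (hxK : K.head x w) : K.Dir w t := by
  have hne : x ≠ t := by
    rintro rfl
    exact ht.2 hx
  have hwt := G.adj_of_head _ _ ht.1
  have := hs.collider x w t hne hn (G.adj_of_head _ _ hx) hwt
  exact hK.dir_of_not_head ((hs.adj _ _).1 hwt) fun h => ht.2 (this.2 ⟨hxK, h⟩).2

/-- An edge from a collider of an open walk to some vertex `t` is directed in `K` as well, unless
`t` can be joined to an earlier vertex of the walk. -/
theorem OpenWalk.dir_or_exists_left (hG : G.IsMVRChainGraph) (hK : K.IsMVRChainGraph)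
    (hs : G.SameColliders K) {n : ℕ} {v : ℕ → V} (h : G.OpenWalk Z n v)
    (hc : CollidersTransfer G K n v) {t : V} (m : ℕ) (hm : m + 1 < n)
    (h1 : G.head (v m) (v (m + 1))) (h2 : G.head (v (m + 2)) (v (m + 1)))
    (ht : G.Dir (v (m + 1)) t) :
    K.Dir (v (m + 1)) t ∨ ∃ l ≤ m, G.head (v l) t ∧
      ∀ k, l = k + 1 → G.Open Z (v k) (v l) t := by
  induction m with
  | zero =>
    by_cases ha : G.skel.Adj (v 0) t
    · exact .inr ⟨0, le_rfl, hG.head_trans h1 ht.1 ha, by simp⟩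
    · exact .inl (hs.dir_of_unshielded hK h1 ht ha (hc 0 hm h1 h2).1)
  | succ k ih =>
    by_cases ha : G.skel.Adj (v (k + 1)) t
    · by_cases ho : G.Open Z (v k) (v (k + 1)) t
      · refine .inr ⟨k + 1, le_rfl, hG.head_trans h1 ht.1 ha, ?_⟩
        rintro k' hk'
        obtain rfl : k = k' := by omega
        exact ho
      -- The jump from `v (k + 1)` to `t` is blocked, so `v (k + 1)` is itself a collider with a
      -- directed edge to `t`. The induction moves one vertex to the left; if `K` directs that edge,
      -- acyclicity of `K` directs the original one as well.
      · have hd := hG.dir_of_head_dir h1 ht ha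
        obtain ⟨-, h3, h4⟩ := (h.opn k (by omega)).head_of_not_open hd ho
        rcases ih (by omega) h3 h4 hd with hk | ⟨l, hl, hlt, hlo⟩
        · exact .inl (hK.dir_of_head_dir (hc k (by omega) h3 h4).2 hk
            ((hs.adj _ _).1 (G.adj_of_head _ _ ht.1)))
        · exact .inr ⟨l, by omega, hlt, hlo⟩
    · exact .inl (hs.dir_of_unshielded hK h1 ht ha (hc (k + 1) hm h1 h2).1)

theorem OpenWalk.dir_or_exists_right (hG : G.IsMVRChainGraph) (hK : K.IsMVRChainGraph)
    (hs : G.SameColliders K) {n : ℕ} {v : ℕ → V} (h : G.OpenWalk Z n v)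
    (hc : CollidersTransfer G K n v) {t : V} (m : ℕ) (hm : m + 1 < n)
    (h1 : G.head (v m) (v (m + 1))) (h2 : G.head (v (m + 2)) (v (m + 1)))
    (ht : G.Dir (v (m + 1)) t) :
    K.Dir (v (m + 1)) t ∨ ∃ r, m + 2 ≤ r ∧ r ≤ n ∧ G.head (v r) t ∧
      (r < n → G.Open Z t (v r) (v (r + 1))) := by
  have e1 : n - (n - (m + 2) + 1) = m + 1 := by omega
  have e2 : n - (n - (m + 2) + 2) = m := by omega
  have e3 : n - (n - (m + 2)) = m + 2 := by omega
  have := h.rev.dir_or_exists_left hG hK hs hc.rev (t := t) (n - (m + 2)) (by omega)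
    (by rwa [e1, e3]) (by rwa [e1, e2]) (by rwa [e1])
  rw [e1] at this
  refine this.imp_right ?_
  rintro ⟨l, hl, hlt, ho⟩
  refine ⟨n - l, by omega, by omega, hlt, fun hr => ?_⟩
  have := ho (l - 1) (by omega)
  rw [show n - (l - 1) = n - l + 1 by omega] at this
  exact this.symm

/-- Skipping `w` can only turn `x` into a collider if `x → w`, and then `x` inherits membership in
`An Z` from `w`. If `x → y`, then `x → w` too, as `y`, `w`, `x` would otherwise violate
`head_trans`; so `x` remains a noncollider. -/
theorem Open.of_collider (hG : G.IsMVRChainGraph) {p x w y : V} (h : G.Open Z p x w)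
    (hxw : G.head x w) (hyw : G.head y w) (hw : w ∈ G.An Z) (hxy : G.skel.Adj x y) :
    G.Open Z p x y := by
  by_cases hyx : G.head y x
  · by_cases hwx : G.head w x
    · exact h.of_head hwx hyx
    · exact h.of_mem_An (mem_An_of_dir (hG.dir_of_not_head (G.adj_of_head _ _ hxw) hwx) hw) hyx
  · refine h.of_dir (hG.dir_of_not_head (G.adj_of_head _ _ hxw) fun hwx => ?_)
      (hG.dir_of_not_head hxy hyx)
    exact hyx (hG.head_trans hyw hwx hxy.symm)

/-- The colliders of a shortest open walk are unshielded. -/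
theorem OpenWalk.unshielded_of_minimal (hG : G.IsMVRChainGraph) {n : ℕ} {v : ℕ → V}
    (h : G.OpenWalk Z n v) (hmin : ∀ m < n, ¬ G.OpenConn Z (v 0) (v n) m) {i : ℕ}
    (hi : i + 1 < n) (h1 : G.head (v i) (v (i + 1))) (h2 : G.head (v (i + 2)) (v (i + 1))) :
    ¬ G.skel.Adj (v i) (v (i + 2)) := by
  intro ha
  have hw := (h.opn i hi).1 ⟨h1, h2⟩
  refine hmin _ ?_ (h.shortcut (l := i) (r := i + 2) (by omega) (by omega) ha ?_ ?_)
  · omega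
  · rintro k rfl
    exact (h.opn k (by omega)).of_collider hG h1 h2 hw ha
  · intro hn
    exact ((h.opn (i + 1) hn).symm.of_collider hG h2 h1 hw ha.symm).symm

theorem SameColliders.collidersTransfer (hs : G.SameColliders K) (hG : G.IsMVRChainGraph) {n : ℕ}
    {v : ℕ → V} (h : G.OpenWalk Z n v) (hinj : Set.InjOn v (Set.Iic n))
    (hmin : ∀ m < n, ¬ G.OpenConn Z (v 0) (v n) m) : CollidersTransfer G K n v := by
  intro i hi h1 h2
  refine (hs.collider _ _ _ ?_ (h.unshielded_of_minimal hG hmin hi h1 h2) (G.adj_of_head _ _ h1)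
    (G.adj_of_head _ _ h2).symm).1 ⟨h1, h2⟩
  intro he
  have := hinj (x₁ := i) (x₂ := i + 2) (by simp; omega) (by simp; omega) he
  omega

/-- If `K` directs `v (k + 1) → v (k + 3)`, the two arrowheads at `v (k + 2)` and the transferred
one at `v (k + 1)` contradict acyclicity of `K`. Otherwise `v (k + 3)` can be joined to an earlier
vertex, which shortens the walk. -/
theorem OpenWalk.shielded_aux (hG : G.IsMVRChainGraph) (hK : K.IsMVRChainGraph)
    (hs : G.SameColliders K) {n : ℕ} {v : ℕ → V} (h : G.OpenWalk Z n v)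
    (hc : CollidersTransfer G K n v) (hmin : ∀ m < n, ¬ G.OpenConn Z (v 0) (v n) m) {k : ℕ}
    (hk : k + 2 < n) (hxy : G.Dir (v (k + 1)) (v (k + 3))) (hwy : G.Dir (v (k + 2)) (v (k + 3)))
    (h1 : G.head (v k) (v (k + 1))) (h2 : G.head (v (k + 2)) (v (k + 1))) :
    ¬ (K.head (v (k + 1)) (v (k + 2)) ∧ K.head (v (k + 3)) (v (k + 2))) := by
  rintro ⟨h3, h4⟩
  rcases h.dir_or_exists_left hG hK hs hc k (by omega) h1 h2 hxy with hd | ⟨l, hl, hlt, ho⟩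
  · exact hd.2 (hK.head_trans h4 (hc k (by omega) h1 h2).2 (K.adj_of_head _ _ hd.1).symm)
  · refine hmin _ ?_ (h.shortcut (l := l) (r := k + 3) (by omega) (by omega)
      (G.adj_of_head _ _ hlt) ho fun hn => ?_)
    · omega
    · exact ((h.opn (k + 2) hn).symm.of_head hwy.1 hlt).symm

/-- The noncolliders of a shortest open walk are noncolliders in `K`. -/
theorem OpenWalk.shielded (hG : G.IsMVRChainGraph) (hK : K.IsMVRChainGraph)
    (hs : G.SameColliders K) {n : ℕ} {v : ℕ → V} (h : G.OpenWalk Z n v)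
    (hc : CollidersTransfer G K n v) (hmin : ∀ m < n, ¬ G.OpenConn Z (v 0) (v n) m) {i : ℕ}
    (hi : i + 1 < n) (ha : G.skel.Adj (v i) (v (i + 2)))
    (hwy : G.Dir (v (i + 1)) (v (i + 2))) :
    ¬ (K.head (v i) (v (i + 1)) ∧ K.head (v (i + 2)) (v (i + 1))) := by
  have hxw := h.adj i (by omega)
  have hno : ¬ ((∀ k, i = k + 1 → G.Open Z (v k) (v i) (v (i + 2))) ∧
      (i + 2 < n → G.Open Z (v i) (v (i + 2)) (v (i + 3)))) := fun ⟨o1, o2⟩ =>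
    hmin _ (by omega) (h.shortcut (l := i) (r := i + 2) (by omega) (by omega) ha o1 o2)
  -- By minimality the chord is blocked at one of its ends. With an arrowhead at `v (i + 2)` that
  -- end keeps its status, so the blocked end is `v i`, which must be a collider. Without it the
  -- roles are exchanged, and the reversed walk is used.
  by_cases hh : G.head (v i) (v (i + 2))
  · have o2 : i + 2 < n → G.Open Z (v i) (v (i + 2)) (v (i + 3)) := fun hn =>
      ((h.opn (i + 1) hn).symm.of_head hwy.1 hh).symm
    have o1 : ¬ ∀ k, i = k + 1 → G.Open Z (v k) (v i) (v (i + 2)) := fun o1 => hno ⟨o1, o2⟩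
    push Not at o1
    obtain ⟨k, rfl, ho⟩ := o1
    have hxy : G.Dir (v (k + 1)) (v (k + 3)) := by
      refine hG.dir_of_not_head ha fun hyx => ?_
      by_cases hwx : G.head (v (k + 2)) (v (k + 1))
      · exact ho ((h.opn k (by omega)).of_head hwx hyx)
      · exact (hG.dir_of_dir_head (hG.dir_of_not_head hxw hwx) hwy.1 ha).2 hyx
    obtain ⟨-, h1, h2⟩ := (h.opn k (by omega)).head_of_not_open hxy ho
    exact h.shielded_aux hG hK hs hc hmin hi hxy hwy h1 h2
  · have hyx := hG.dir_of_not_head ha.symm hh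
    have hwx := hG.dir_of_dir_head hwy hyx.1 hxw.symm
    have o1 : ∀ k, i = k + 1 → G.Open Z (v k) (v i) (v (i + 2)) := by
      rintro k rfl
      exact (h.opn k (by omega)).of_head hwx.1 hyx.1
    have o2 : ¬ (i + 2 < n → G.Open Z (v i) (v (i + 2)) (v (i + 3))) := fun o2 => hno ⟨o1, o2⟩
    push Not at o2
    obtain ⟨hn, ho⟩ := o2
    obtain ⟨-, h1, h2⟩ := (h.opn (i + 1) hn).symm.head_of_not_open hyx fun h' => ho h'.symm
    have e0 : n - (n - (i + 3)) = i + 3 := by omega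
    have e1 : n - (n - (i + 3) + 1) = i + 2 := by omega
    have e2 : n - (n - (i + 3) + 2) = i + 1 := by omega
    have e3 : n - (n - (i + 3) + 3) = i := by omega
    have := h.rev.shielded_aux hG hK hs hc.rev (k := n - (i + 3))
      (fun m hm hcon => hmin m hm (by simpa using hcon.symm)) (by omega)
      (by rwa [e1, e3]) (by rwa [e2, e3]) (by rwa [e0, e1]) (by rwa [e2, e1])
    rw [e1, e2, e3] at this
    exact fun h' => this h'.symm

theorem OpenWalk.noncollider_transfer (hG : G.IsMVRChainGraph) (hK : K.IsMVRChainGraph)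
    (hs : G.SameColliders K) {n : ℕ} {v : ℕ → V} (h : G.OpenWalk Z n v)
    (hinj : Set.InjOn v (Set.Iic n))
    (hmin : ∀ m < n, ¬ G.OpenConn Z (v 0) (v n) m) {i : ℕ} (hi : i + 1 < n)
    (hnc : ¬ (G.head (v i) (v (i + 1)) ∧ G.head (v (i + 2)) (v (i + 1)))) :
    ¬ (K.head (v i) (v (i + 1)) ∧ K.head (v (i + 2)) (v (i + 1))) := by
  have hc := hs.collidersTransfer hG h hinj hmin
  have a1 := h.adj i (by omega)
  have a2 := h.adj (i + 1) (by omega)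
  by_cases ha : G.skel.Adj (v i) (v (i + 2))
  · by_cases hh : G.head (v (i + 2)) (v (i + 1))
    · have hwx : G.Dir (v (i + 1)) (v i) :=
        hG.dir_of_not_head a1.symm fun h' => hnc ⟨h', hh⟩
      have e0 : n - (n - (i + 2)) = i + 2 := by omega
      have e1 : n - (n - (i + 2) + 1) = i + 1 := by omega
      have e2 : n - (n - (i + 2) + 2) = i := by omega
      have := h.rev.shielded hG hK hs hc.rev (i := n - (i + 2))
        (fun m hm hcon => hmin m hm (by simpa using hcon.symm)) (by omega)
        (by rw [e0, e2]; exact ha.symm) (by rwa [e1, e2])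
      rw [e0, e1, e2] at this
      exact fun h' => this h'.symm
    · exact h.shielded hG hK hs hc hmin hi ha (hG.dir_of_not_head a2 hh)
  · rwa [← hs.collider _ _ _ _ ha a1 a2]
    intro he
    have := hinj (x₁ := i) (x₂ := i + 2) (by simp; omega) (by simp; omega) he
    omega

/-- There is a directed walk of length `k` from `x` to `Z`. -/
def DirLen (G : MixedGraph V) (Z : Finset V) : ℕ → V → Prop
  | 0, x => x ∈ Z
  | k + 1, x => ∃ y, G.Dir x y ∧ G.DirLen Z k y

theorem mem_An_iff_exists_dirLen {x : V} : x ∈ G.An Z ↔ ∃ k, G.DirLen Z k x := by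
  constructor
  · rintro ⟨z, hz, hxz⟩
    induction hxz using ReflTransGen.head_induction_on with
    | refl => exact ⟨0, hz⟩
    | head hxy _ ih =>
      obtain ⟨k, hk⟩ := ih
      exact ⟨k + 1, _, hxy, hk⟩
  · rintro ⟨k, hk⟩
    induction k generalizing x with
    | zero => exact mem_An_of_mem hk
    | succ k ih =>
      obtain ⟨y, hy, hk⟩ := hk
      exact mem_An_of_dir hy (ih hk)

/-- The distance from `x` to `Z` along directed edges. -/
noncomputable def zdist (G : MixedGraph V) (Z : Finset V) (x : V) : ℕ :=
  sInf {k | G.DirLen Z k x}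

theorem dirLen_zdist {x : V} (h : x ∈ G.An Z) : G.DirLen Z (G.zdist Z x) x :=
  Nat.sInf_mem (mem_An_iff_exists_dirLen.1 h)

theorem zdist_le {x : V} {k : ℕ} (h : G.DirLen Z k x) : G.zdist Z x ≤ k := Nat.sInf_le h

/-- The first edge of a shortest directed path determines the directions of the others. -/
theorem SameColliders.mem_An_of_dir (hG : G.IsMVRChainGraph) (hK : K.IsMVRChainGraph)
    (hs : G.SameColliders K) (k : ℕ) {c d : V} (h1 : G.Dir c d) (h2 : K.Dir c d)
    (hd : G.DirLen Z k d) (hc : ∀ j ≤ k, ¬ G.DirLen Z j c) : d ∈ K.An Z := by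
  induction k generalizing c d with
  | zero => exact mem_An_of_mem hd
  | succ k ih =>
    obtain ⟨e, he, hk⟩ := hd
    -- Otherwise `c → e`, and a shorter directed walk from `c` to `Z` would bypass `d`.
    -- Unshieldedness forces the next edge in `K`.
    have hce : ¬ G.skel.Adj c e := fun ha =>
      hc (k + 1) le_rfl ⟨e, hG.dir_of_dir_head h1 he.1 ha, hk⟩
    have he' := hs.dir_of_unshielded hK h1.1 he hce h2.1
    exact MixedGraph.mem_An_of_dir he'
      (ih he he' hk fun j hj hjd => hc (j + 1) (by omega) ⟨d, h1, hjd⟩)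

open Classical in
/-- The sum of the distances of the colliders to `Z`. -/
noncomputable def weight (G : MixedGraph V) (Z : Finset V) (n : ℕ) (v : ℕ → V) : ℕ :=
  ∑ i ∈ Finset.range (n - 1),
    if G.head (v i) (v (i + 1)) ∧ G.head (v (i + 2)) (v (i + 1)) then G.zdist Z (v (i + 1)) else 0

theorem OpenWalk.update {n i : ℕ} {v : ℕ → V} {d : V} (h : G.OpenWalk Z n v) (hi : i + 1 < n)
    (h1 : G.head (v i) d) (h2 : G.head (v (i + 2)) d) (hd : d ∈ G.An Z)
    (ho1 : ∀ k, i = k + 1 → G.Open Z (v k) (v i) d)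
    (ho2 : i + 2 < n → G.Open Z d (v (i + 2)) (v (i + 3))) :
    G.OpenWalk Z n (Function.update v (i + 1) d) := by
  have hne : ∀ j, j ≠ i + 1 → Function.update v (i + 1) d j = v j := fun j hj =>
    Function.update_of_ne hj _ _
  have heq : Function.update v (i + 1) d (i + 1) = d := Function.update_self _ _ _
  constructor
  · intro j hj
    by_cases c1 : j = i
    · subst c1
      rw [heq, hne _ (by omega)]
      exact G.adj_of_head _ _ h1
    · by_cases c2 : j = i + 1
      · subst c2
        rw [heq, hne _ (by omega)]
        exact (G.adj_of_head _ _ h2).symm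
      · rw [hne _ c2, hne _ (by omega)]
        exact h.adj j hj
  · intro j hj
    by_cases c0 : i = j + 1
    · subst c0
      rw [heq, hne _ (by omega), hne _ (by omega)]
      exact ho1 j rfl
    · by_cases c1 : j = i
      · subst c1
        rw [heq, hne _ (by omega), hne _ (by omega)]
        exact ⟨fun _ => hd, fun hh => absurd ⟨h1, h2⟩ hh⟩
      · by_cases c2 : j = i + 1
        · subst c2
          rw [heq, hne _ (by omega), hne _ (by omega)]
          exact ho2 (by omega)
        · rw [hne _ c2, hne _ (by omega), hne _ (by omega)]
          exact h.opn j hj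

/-- The tails at `v i` and `v (i + 2)` make these neighbours noncolliders, so the only collider
whose contribution changes without vanishing is the replaced one, and `d` is nearer to `Z`. -/
theorem weight_update_lt {n i : ℕ} {v : ℕ → V} {d : V} (hi : i + 1 < n)
    (h1 : G.head (v i) (v (i + 1))) (h2 : G.head (v (i + 2)) (v (i + 1)))
    (h3 : G.Dir (v i) d) (h4 : G.Dir (v (i + 2)) d)
    (hlt : G.zdist Z d < G.zdist Z (v (i + 1))) :
    G.weight Z n (Function.update v (i + 1) d) < G.weight Z n v := by
  have hne : ∀ j, j ≠ i + 1 → Function.update v (i + 1) d j = v j := fun j hj =>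
    Function.update_of_ne hj _ _
  have heq : Function.update v (i + 1) d (i + 1) = d := Function.update_self _ _ _
  refine Finset.sum_lt_sum (fun j _ => ?_) ⟨i, by simp; omega, ?_⟩
  · by_cases c0 : i = j + 1
    · subst c0
      rw [hne _ (by omega : j ≠ _), hne _ (by omega : j + 1 ≠ _), heq, if_neg fun hh => h3.2 hh.2]
      exact Nat.zero_le _
    · by_cases c1 : j = i
      · subst c1
        rw [heq, hne _ (by omega : j ≠ _), hne _ (by omega : j + 2 ≠ _), if_pos ⟨h3.1, h4.1⟩,
          if_pos ⟨h1, h2⟩]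
        exact hlt.le
      · by_cases c2 : j = i + 1
        · subst c2
          rw [heq, hne _ (by omega : i + 1 + 1 ≠ _), if_neg fun hh => h4.2 hh.1]
          exact Nat.zero_le _
        · rw [hne _ c2, hne _ (by omega : j + 1 ≠ _), hne _ (by omega : j + 2 ≠ _)]
  · rw [heq, hne _ (by omega : i ≠ _), hne _ (by omega : i + 2 ≠ _), if_pos ⟨h3.1, h4.1⟩,
      if_pos ⟨h1, h2⟩]
    exact hlt

theorem OpenWalk.collider_mem_An (hG : G.IsMVRChainGraph) (hK : K.IsMVRChainGraph)
    (hs : G.SameColliders K) {n : ℕ} {v : ℕ → V} (h : G.OpenWalk Z n v)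
    (hinj : Set.InjOn v (Set.Iic n))
    (hmin : ∀ m < n, ¬ G.OpenConn Z (v 0) (v n) m)
    (hw : ∀ w, G.OpenWalk Z n w → w 0 = v 0 → w n = v n → G.weight Z n v ≤ G.weight Z n w)
    {i : ℕ} (hi : i + 1 < n) (h1 : G.head (v i) (v (i + 1)))
    (h2 : G.head (v (i + 2)) (v (i + 1))) : v (i + 1) ∈ K.An Z := by
  have hc := hs.collidersTransfer hG h hinj hmin
  have hAn := (h.opn i hi).1 ⟨h1, h2⟩
  have hlen := dirLen_zdist hAn
  rcases hz : G.zdist Z (v (i + 1)) with _ | k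
  · rw [hz] at hlen
    exact mem_An_of_mem hlen
  · rw [hz] at hlen
    obtain ⟨d, hd, hk⟩ := hlen
    have hdA : d ∈ G.An Z := mem_An_iff_exists_dirLen.2 ⟨k, hk⟩
    have hdK : K.Dir (v (i + 1)) d := by
      rcases h.dir_or_exists_left hG hK hs hc i hi h1 h2 hd with hl | ⟨l, hl, hld, hlo⟩
      · exact hl
      rcases h.dir_or_exists_right hG hK hs hc i hi h1 h2 hd with hr | ⟨r, hr, hrn, hrd, hro⟩
      · exact hr
      exfalso
      -- The detour through `d` is shorter unless it replaces just `v (i + 1)`; in that case the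
      -- length is kept and the weight drops.
      by_cases hlr : l = i ∧ r = i + 2
      · obtain ⟨rfl, rfl⟩ := hlr
        have := hw _ (h.update hi hld hrd hdA hlo hro)
          (Function.update_of_ne (by omega) _ _) (Function.update_of_ne (by omega) _ _)
        exact absurd this (not_le.2 (weight_update_lt hi h1 h2
          (hG.dir_of_head_dir h1 hd (G.adj_of_head _ _ hld))
          (hG.dir_of_head_dir h2 hd (G.adj_of_head _ _ hrd))
          (by have := zdist_le hk; omega)))
      · exact hmin _ (by omega) (h.detour (by omega) hrn (G.adj_of_head _ _ hld)
          (G.adj_of_head _ _ hrd).symm hlo ⟨fun _ => hdA, fun hh => absurd ⟨hld, hrd⟩ hh⟩ hro)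
    refine mem_An_of_dir hdK (hs.mem_An_of_dir hG hK k hd hdK hk fun j hj hjc => ?_)
    have := zdist_le hjc
    omega

/-- Length is minimised first and `weight` second; the walk obtained in this way is open in `K`
without any change. -/
theorem SameColliders.openConn (hG : G.IsMVRChainGraph) (hK : K.IsMVRChainGraph)
    (hs : G.SameColliders K) {a b : V} (hab : a ≠ b) (h : ∃ n, G.OpenConn Z a b n) :
    ∃ n, K.OpenConn Z a b n := by
  classical
  have hspec := Nat.find_spec h
  have hmin := fun m hm => Nat.find_min (m := m) h hm
  generalize Nat.find h = n at *
  have hW : ∃ k v, G.OpenWalk Z n v ∧ v 0 = a ∧ v n = b ∧ G.weight Z n v = k := by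
    obtain ⟨v, hv, h0, hn⟩ := hspec
    exact ⟨_, v, hv, h0, hn, rfl⟩
  obtain ⟨v, hv, rfl, rfl, hk⟩ := Nat.find_spec hW
  have hw : ∀ w, G.OpenWalk Z n w → w 0 = v 0 → w n = v n →
      G.weight Z n v ≤ G.weight Z n w := fun w hw h0 hn => by
    rw [hk]
    exact Nat.find_min' hW ⟨w, hw, h0, hn, rfl⟩
  have hinj := hv.injOn_of_minimal hG hab hmin
  refine ⟨n, v, ⟨fun i hi => (hs.adj _ _).1 (hv.adj i hi), fun i hi => ?_⟩, rfl, rfl⟩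
  by_cases hcol : G.head (v i) (v (i + 1)) ∧ G.head (v (i + 2)) (v (i + 1))
  · exact ⟨fun _ => hv.collider_mem_An hG hK hs hinj hmin hw hi hcol.1 hcol.2,
      fun hh => absurd (hs.collidersTransfer hG hv hinj hmin i hi hcol.1 hcol.2) hh⟩
  · exact ⟨fun hh => absurd hh (hv.noncollider_transfer hG hK hs hinj hmin hi hcol),
      fun _ => (hv.opn i hi).2 hcol⟩

theorem SameColliders.mSep (hG : G.IsMVRChainGraph) (hK : K.IsMVRChainGraph)
    (hs : G.SameColliders K) {X Y : Finset V} (ht : AdmissibleTriple X Y Z) (h : K.MSep X Y Z) :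
    G.MSep X Y Z := by
  intro a ha b hb c hc
  obtain ⟨-, -, hXY, hXZ, hYZ⟩ := ht
  have hab : a ≠ b := by
    rintro rfl
    exact Finset.disjoint_left.1 hXY ha hb
  have haZ := Finset.disjoint_left.1 hXZ ha
  have hbZ := Finset.disjoint_left.1 hYZ hb
  obtain ⟨c', hc'⟩ := (mSep_iff hK hab haZ hbZ).2
    (hs.openConn hG hK hab ((mSep_iff hG hab haZ hbZ).1 ⟨c, hc⟩))
  exact h a ha b hb c' hc'

/-- Two MVR chain graphs with the same skeleton and the same unshielded colliders are Markov
equivalent. -/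
theorem SameColliders.markovEquivalent (hG : G.IsMVRChainGraph) (hK : K.IsMVRChainGraph)
    (hs : G.SameColliders K) : G.MarkovEquivalent K := by
  ext ⟨X, Y, Z⟩
  exact ⟨fun h => ⟨h.1, hs.symm.mSep hK hG h.1 h.2⟩, fun h => ⟨h.1, hs.mSep hG hK h.1 h.2⟩⟩

end MixedGraph

/-! ### Separation by parents -/

namespace MixedGraph

open Relation

variable {V : Type*} {G K : MixedGraph V} {Z : Finset V}

/-- There is a walk from `u` to `v` along directed and bidirected edges, at least one of which is
directed. -/
def SemiDesc (G : MixedGraph V) (u v : V) : Prop :=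
  ∃ x y, ReflTransGen G.head u x ∧ G.Dir x y ∧ ReflTransGen G.head y v

/-- The two walks form a closed arrowhead walk through a directed edge. So for every nonadjacent
pair, separation by parents works in at least one of the two directions. -/
theorem IsMVRChainGraph.not_semiDesc (hG : G.IsMVRChainGraph) {u v : V} (h : G.SemiDesc u v) :
    ¬ G.SemiDesc v u := by
  rintro ⟨x', y', h1', h2', h3'⟩
  obtain ⟨x, y, h1, h2, h3⟩ := h
  exact hG.not_reflTransGen_of_dir h2
    (h3.trans (h1'.trans ((ReflTransGen.single h2'.1).trans (h3'.trans h1))))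

/-- The parents of `u` separate `u` from its nonneighbours that are not semi-descendants. -/
theorem IsMVRChainGraph.mSep_parents (hG : G.IsMVRChainGraph) {u v : V} (huv : u ≠ v)
    (hn : ¬ G.skel.Adj u v) (hs : ¬ G.SemiDesc u v) (hZ : ∀ x, x ∈ Z ↔ G.Dir x u) :
    G.MSep {u} {v} Z := by
  intro a ha b hb c hc
  obtain rfl := Finset.mem_singleton.1 ha
  obtain rfl := Finset.mem_singleton.1 hb
  have hu : a ∉ Z := fun h => not_head_self a ((hZ a).1 h).1
  have hv : b ∉ Z := fun h => hn (G.adj_of_head _ _ ((hZ b).1 h).1).symm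
  obtain ⟨n, f, hf, rfl, rfl⟩ := (mSep_iff hG huv hu hv).1 ⟨c, hc⟩
  have hn2 : 2 ≤ n := by
    by_contra! hlt
    interval_cases n
    · exact huv rfl
    · exact hn (hf.adj 0 (by omega))
  have h01 : G.head (f 0) (f 1) := by
    by_contra h
    have hd := hG.dir_of_not_head (hf.adj 0 (by omega)).symm h
    exact (hf.opn 0 (by omega)).2 (fun hh => h hh.1) ((hZ _).2 hd)
  have key : ∀ m, m + 1 ≤ n → ReflTransGen G.head (f 0) (f (m + 1)) ∧
      G.head (f m) (f (m + 1)) ∧ (1 ≤ m → G.SemiDesc (f 0) (f (m + 1))) := by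
    intro m
    induction m with
    | zero => exact fun _ => ⟨.single h01, h01, by simp⟩
    | succ m ih =>
      intro hm
      obtain ⟨h1, h2, -⟩ := ih (by omega)
      -- A collider here would be an ancestor of a parent of the starting vertex, although it is
      -- reached from there along arrowheads. So from its second edge on, the walk is directed away
      -- from the start.
      have hd : G.Dir (f (m + 1)) (f (m + 2)) := by
        refine hG.dir_of_not_head (hf.adj _ (by omega)) fun hh => ?_
        obtain ⟨z, hz, hmz⟩ := (hf.opn m (by omega)).1 ⟨h2, hh⟩
        exact hG.not_reflTransGen_of_dir ((hZ z).1 hz)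
          (h1.trans (reflTransGen_head_of_dir hmz))
      exact ⟨h1.tail hd.1, hd.1, fun _ => ⟨_, _, h1, hd, .refl⟩⟩
  obtain ⟨n, rfl⟩ : ∃ k, n = k + 1 := ⟨n - 1, by omega⟩
  exact hs ((key n le_rfl).2.2 (by omega))

theorem MSep.symm {X Y : Finset V} (h : G.MSep X Y Z) (hG : G.IsMVRChainGraph)
    (ht : AdmissibleTriple X Y Z) : G.MSep Y X Z := by
  intro a ha b hb c hc
  obtain ⟨-, -, hXY, hXZ, hYZ⟩ := ht
  have hab : a ≠ b := by
    rintro rfl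
    exact Finset.disjoint_left.1 hXY hb ha
  have haZ := Finset.disjoint_left.1 hYZ ha
  have hbZ := Finset.disjoint_left.1 hXZ hb
  obtain ⟨n, hn⟩ := (mSep_iff hG hab haZ hbZ).1 ⟨c, hc⟩
  obtain ⟨c', hc'⟩ := (mSep_iff hG hab.symm hbZ haZ).2 ⟨n, hn.symm⟩
  exact h b hb a ha c' hc'

theorem admissibleTriple_singleton {u v : V} {T : Finset V} (huv : u ≠ v) (hu : u ∉ T)
    (hv : v ∉ T) : AdmissibleTriple {u} {v} T := by
  simp [AdmissibleTriple, huv, hu, hv]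

theorem not_mSep_of_adj {u v : V} {T : Finset V} (h : G.skel.Adj u v) (hu : u ∉ T) (hv : v ∉ T) :
    ¬ G.MSep {u} {v} T := by
  intro hs
  refine hs u (by simp) v (by simp) (.cons h .nil) ⟨?_, hu, hv, ?_⟩
  · simp [h.ne]
  · intro i h1 h2
    simp at h2
    omega

/-- A separator of the ends of an unshielded triple contains the middle vertex iff that vertex is
not a collider. -/
theorem MSep.notMem_iff (hG : G.IsMVRChainGraph) {u w v : V} {T : Finset V} (h : G.MSep {u} {v} T)
    (huv : u ≠ v) (hu : u ∉ T) (hv : v ∉ T) (h1 : G.skel.Adj u w) (h2 : G.skel.Adj w v) :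
    w ∉ T ↔ G.head u w ∧ G.head v w := by
  by_contra hcon
  have ho : G.Open T u w v := by
    unfold Open
    have : w ∈ T → w ∈ G.An T := mem_An_of_mem
    tauto
  have hw : G.OpenWalk T 2 fun k => if k = 0 then u else if k = 1 then w else v := by
    constructor
    · intro i hi
      interval_cases i
      · simpa using h1
      · simpa using h2
    · intro i hi
      obtain rfl : i = 0 := by omega
      simpa using ho
  obtain ⟨c, hc⟩ := (mSep_iff hG huv hu hv).2 ⟨2, _, hw, rfl, rfl⟩
  exact h u (by simp) v (by simp) c hc

end MixedGraph

/-! ### Forced arrowheads and the graph that carries exactly them -/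

namespace StablePC

open MixedGraph Relation

variable {V : Type*} {G K M : MixedGraph V} {S : V → V → Option (Finset V)}

/-- `S` records a separator in `G` for every pair of nonadjacent vertices and no others. -/
structure SepInfo (S : V → V → Option (Finset V)) (G : MixedGraph V) : Prop where
  ne : ∀ {u v T}, S u v = some T → u ≠ v
  not_adj : ∀ {u v T}, S u v = some T → ¬ G.skel.Adj u v
  notMem_left : ∀ {u v T}, S u v = some T → u ∉ T
  notMem_right : ∀ {u v T}, S u v = some T → v ∉ T
  mSep : ∀ {u v T}, S u v = some T → G.MSep {u} {v} T
  comm : ∀ u v, S u v = S v u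
  total : ∀ {u v}, u ≠ v → ¬ G.skel.Adj u v → ∃ T, S u v = some T

theorem SepInfo.notMem_iff (h : SepInfo S G) (hG : G.IsMVRChainGraph) {u w v : V} {T : Finset V}
    (hT : S u v = some T) (h1 : G.skel.Adj u w) (h2 : G.skel.Adj w v) :
    w ∉ T ↔ G.head u w ∧ G.head v w :=
  (h.mSep hT).notMem_iff hG (h.ne hT) (h.notMem_left hT) (h.notMem_right hT) h1 h2

/-- Markov equivalent graphs have the same skeleton. -/
theorem skel_eq_of_markovEquivalent [Fintype V] (hG : G.IsMVRChainGraph) (hK : K.IsMVRChainGraph)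
    (h : K.MarkovEquivalent G) : K.skel = G.skel := by
  classical
  have key : ∀ {G K : MixedGraph V}, G.IsMVRChainGraph → K.MarkovEquivalent G →
      ∀ u v, K.skel.Adj u v → G.skel.Adj u v := by
    intro G K hG h u v ha
    by_contra hn
    wlog hs : ¬ G.SemiDesc u v generalizing u v
    · exact this v u ha.symm (fun h' => hn h'.symm) (hG.not_semiDesc (not_not.1 hs))
    have hsep := hG.mSep_parents ha.ne hn hs (Z := Finset.univ.filter fun x => G.Dir x u)
      (by simp)
    have hu : u ∉ Finset.univ.filter fun x => G.Dir x u := by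
      simpa using fun h : G.Dir u u => not_head_self u h.1
    have hv : v ∉ Finset.univ.filter fun x => G.Dir x u := by
      simpa using fun h : G.Dir v u => hn (G.adj_of_head _ _ h.1).symm
    have hmem : (({u} : Finset V), ({v} : Finset V), Finset.univ.filter fun x => G.Dir x u) ∈
        K.indepModel := by
      rw [h]
      exact ⟨admissibleTriple_singleton ha.ne hu hv, hsep⟩
    exact not_mSep_of_adj ha hu hv hmem.2
  ext u v
  exact ⟨key hG h u v, key hK h.symm u v⟩

/-- The recorded data depend only on the skeleton and the independence model, which equivalent
graphs share; hence soundness of the rules applies to every member of the class. -/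
theorem SepInfo.of_markovEquivalent [Fintype V] (hS : SepInfo S G) (hG : G.IsMVRChainGraph)
    (hK : K.IsMVRChainGraph) (h : K.MarkovEquivalent G) : SepInfo S K where
  ne := hS.ne
  not_adj := by
    rw [skel_eq_of_markovEquivalent hG hK h]
    exact hS.not_adj
  notMem_left := hS.notMem_left
  notMem_right := hS.notMem_right
  mSep {u v T} hT := by
    have hmem : (({u} : Finset V), ({v} : Finset V), T) ∈ K.indepModel := by
      rw [h]
      exact ⟨admissibleTriple_singleton (hS.ne hT) (hS.notMem_left hT) (hS.notMem_right hT),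
        hS.mSep hT⟩
    exact hmem.2
  comm := hS.comm
  total := by
    rw [skel_eq_of_markovEquivalent hG hK h]
    exact hS.total

/-- The arrowheads that the `v`-structures and the orientation rules imply. -/
inductive Forced (S : V → V → Option (Finset V)) (H : SimpleGraph V) : V → V → Prop
  | vStructure {u w v : V} {T : Finset V} : H.Adj u w → H.Adj w v → S u v = some T → w ∉ T →
      Forced S H u w
  | rule1 {u a b : V} {T : Finset V} : Forced S H u a → H.Adj a b → S u b = some T → a ∈ T →
      Forced S H a b
  | rule2 {a u b : V} : Forced S H a u → Forced S H u b → H.Adj a b → Forced S H a b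
  | rule3 {u v a b : V} {T : Finset V} : Forced S H u b → Forced S H v b → H.Adj a u → H.Adj a v →
      H.Adj a b → S u v = some T → a ∈ T → Forced S H a b

theorem Forced.adj {H : SimpleGraph V} {a b : V} (h : Forced S H a b) : H.Adj a b := by
  cases h <;> assumption

/-- The forced arrowheads are present in every compatible graph. -/
theorem Forced.head (hS : SepInfo S K) (hK : K.IsMVRChainGraph) {a b : V}
    (h : Forced S K.skel a b) : K.head a b := by
  induction h with
  | vStructure h1 h2 hT hw => exact ((hS.notMem_iff hK hT h1 h2).1 hw).1
  | @rule1 u a b T hu hab hT ha ih =>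
    by_contra hcon
    have := (hK.dir_of_not_head hab.symm hcon).1
    exact (hS.notMem_iff hK hT hu.adj hab).2 ⟨ih, this⟩ ha
  | rule2 h1 h2 hab ih1 ih2 => exact hK.head_trans ih1 ih2 hab
  | @rule3 u v a b T hu hv hau hav hab hT ha ihu ihv =>
    by_contra hcon
    have hd := hK.dir_of_not_head hab.symm hcon
    exact (hS.notMem_iff hK hT hau.symm hav).2
      ⟨(hK.dir_of_head_dir ihu hd hau.symm).1, (hK.dir_of_head_dir ihv hd hav.symm).1⟩ ha

/-- `M` is a graph with the skeleton of `G` and exactly the forced arrowheads. -/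
structure IsEssential (S : V → V → Option (Finset V)) (G M : MixedGraph V) : Prop where
  mvr : G.IsMVRChainGraph
  sep : SepInfo S G
  skel : M.skel = G.skel
  head_iff : ∀ a b, M.head a b ↔ Forced S G.skel a b

namespace IsEssential

theorem head_sound (h : IsEssential S G M) {a b : V} (hab : M.head a b) : G.head a b :=
  ((h.head_iff a b).1 hab).head h.sep h.mvr

theorem head_trans (h : IsEssential S G M) {a u b : V} (h1 : M.head a u) (h2 : M.head u b)
    (hab : M.skel.Adj a b) : M.head a b := by
  rw [h.head_iff] at *
  exact .rule2 h1 h2 (h.skel ▸ hab)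

theorem head_of_collider (h : IsEssential S G M) {u w v : V} (huv : u ≠ v)
    (hn : ¬ M.skel.Adj u v) (h1 : G.head u w) (h2 : G.head v w) : M.head u w := by
  rw [h.skel] at hn
  obtain ⟨T, hT⟩ := h.sep.total huv hn
  have a1 := G.adj_of_head _ _ h1
  have a2 := (G.adj_of_head _ _ h2).symm
  exact (h.head_iff _ _).2 (.vStructure a1 a2 hT ((h.sep.notMem_iff h.mvr hT a1 a2).2 ⟨h1, h2⟩))

theorem head_or_of_unshielded (h : IsEssential S G M) {u a b : V} (hub : u ≠ b)
    (hn : ¬ M.skel.Adj u b) (hu : M.head u a) (hab : M.skel.Adj a b) :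
    M.head a b ∨ M.head b a := by
  rw [h.skel] at hn
  obtain ⟨T, hT⟩ := h.sep.total hub hn
  simp only [h.head_iff]
  rw [h.skel] at hab
  by_cases ha : a ∈ T
  · exact .inl (.rule1 ((h.head_iff _ _).1 hu) hab hT ha)
  · exact .inr (.vStructure hab.symm ((h.head_iff _ _).1 hu).adj.symm
      (by rw [h.sep.comm]; exact hT) ha)

/-- If `y` and `w` were nonadjacent, membership of `x` in their separator would decide between rule
1 and a v-structure, and either orients the edge between `x` and `w`. -/
theorem adj_of_head_und (h : IsEssential S G M) {y x w : V} (hyx : M.head y x) (hxw : M.Und x w) :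
    M.skel.Adj y w := by
  by_contra hn
  have hne : y ≠ w := by
    rintro rfl
    exact hxw.2.2 hyx
  rcases h.head_or_of_unshielded hne hn hyx hxw.1 with h' | h'
  · exact hxw.2.1 h'
  · exact hxw.2.2 h'

/-- Arrowheads propagate along undirected edges. -/
theorem head_of_head_und (h : IsEssential S G M) {y x w : V} (hyx : M.head y x)
    (hxw : M.Und x w) : M.head y w := by
  rw [h.head_iff] at hyx
  induction hyx generalizing w with
  | @vStructure y x z T h1 h2 hT hx =>
    have hyx : M.head y x := (h.head_iff _ _).2 (.vStructure h1 h2 hT hx)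
    have hzx : M.head z x :=
      (h.head_iff _ _).2 (.vStructure h2.symm h1.symm (by rw [h.sep.comm]; exact hT) hx)
    have hyw := h.adj_of_head_und hyx hxw
    have hzw := h.adj_of_head_und hzx hxw
    rw [h.skel] at hyw hzw
    -- For `w ∈ T` rule 3 would orient the undirected edge; otherwise `w` is a collider between `y`
    -- and `z` as well.
    by_cases hw : w ∈ T
    · refine absurd ((h.head_iff _ _).2 ?_) hxw.2.2
      exact .rule3 ((h.head_iff _ _).1 hyx) ((h.head_iff _ _).1 hzx) hyw.symm hzw.symm
        (h.skel ▸ hxw.1.symm) hT hw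
    · exact (h.head_iff _ _).2 (.vStructure hyw hzw.symm hT hw)
  | @rule1 u y x T hu hyx hT hy ih =>
    have hyx' : M.head y x := (h.head_iff _ _).2 (.rule1 hu hyx hT hy)
    have hyw := h.adj_of_head_und hyx' hxw
    by_contra hcon
    -- An arrowhead at `y` would orient the edge between `w` and `x` by rule 2. Otherwise `y - w` is
    -- undirected, the arrowhead from `u` moves on to `w`, and the unshielded triple `u, w, x`
    -- orients that edge.
    by_cases hwy : M.head w y
    · exact hxw.2.2 (h.head_trans hwy hyx' hxw.1.symm)
    · have huw := ih ⟨hyw, hcon, hwy⟩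
      have hn : ¬ M.skel.Adj u x := by
        rw [h.skel]
        exact h.sep.not_adj hT
      rcases h.head_or_of_unshielded (h.sep.ne hT) hn huw hxw.1.symm with h' | h'
      · exact hxw.2.2 h'
      · exact hxw.2.1 h'
  | @rule2 y u x h1 h2 hyx ih1 ih2 =>
    have hyx' : M.head y x := (h.head_iff _ _).2 (.rule2 h1 h2 hyx)
    exact h.head_trans ((h.head_iff _ _).2 h1) (ih2 hxw) (h.adj_of_head_und hyx' hxw)
  | @rule3 u v y x T hu hv hyu hyv hyx hT hy ihu ihv =>
    have hyx' : M.head y x := (h.head_iff _ _).2 (.rule3 hu hv hyu hyv hyx hT hy)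
    have hyw := h.adj_of_head_und hyx' hxw
    rw [h.skel] at hyw
    exact (h.head_iff _ _).2 (.rule3 ((h.head_iff _ _).1 (ihu hxw)) ((h.head_iff _ _).1 (ihv hxw))
      hyu hyv hyw hT hy)

/-- Adjacent vertices in the same component of undirected edges are joined by an undirected
edge. -/
theorem und_of_und_und (h : IsEssential S G M) {y w z : V} (hy : M.Und y w) (hz : M.Und z w)
    (hyz : M.skel.Adj y z) : M.Und y z := by
  have key : ∀ y z, M.Und y w → M.Und z w → ¬ M.head y z := fun y z hy hz hh =>
    hy.2.1 (h.head_of_head_und hh hz)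
  exact ⟨hyz, key y z hy hz, key z y hz hy⟩

theorem dir_of_dir_und (h : IsEssential S G M) {y x w : V} (hyx : M.Dir y x) (hxw : M.Und x w) :
    M.Dir y w :=
  ⟨h.head_of_head_und hyx.1 hxw, fun hwy => hxw.2.2 (h.head_trans hwy hyx.1 hxw.1.symm)⟩

/-- Arrowheads never leave a nontrivial undirected component along bidirected edges. -/
theorem dir_of_und_head (h : IsEssential S G M) {a b c : V} (hab : M.Und a b) (hbc : M.head b c) :
    M.Dir b c := by
  refine ⟨hbc, fun hcb => ?_⟩
  exact hab.2.2 (h.head_trans hbc (h.head_of_head_und hcb ⟨hab.1.symm, hab.2.2, hab.2.1⟩)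
    hab.1.symm)

/-- Let `w` be the last vertex before `y` on a returning walk. If `w` and `x` are adjacent, then `w
→ x` and the walk gets shorter. If not, `y → x` is directed in `G` too, as an arrowhead at `y` would
make `y` an unshielded collider; then acyclicity of `G` applies. -/
theorem not_transGen_of_dir (h : IsEssential S G M) {y x : V} (hd : M.Dir y x) :
    ¬ ReflTransGen M.head x y := by
  intro hw
  generalize hy : y = y' at hw
  induction hw generalizing y with
  | refl =>
    subst hy
    exact not_head_self _ hd.1
  | @tail w y' hxw hwy ih =>
    subst hy
    have hwx : w ≠ x := by
      rintro rfl
      exact hd.2 hwy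
    by_cases ha : M.skel.Adj w x
    · exact ih ⟨h.head_trans hwy hd.1 ha,
        fun hxw' => hd.2 (h.head_trans hxw' hwy (M.adj_of_head _ _ hd.1).symm)⟩ rfl
    · have hGd : G.Dir y x := by
        refine ⟨h.head_sound hd.1, fun hxy => hd.2 ?_⟩
        exact h.head_of_collider hwx.symm (fun h' => ha h'.symm) hxy (h.head_sound hwy)
      exact h.mvr.not_reflTransGen_of_dir hGd
        (ReflTransGen.mono (fun _ _ h' => h.head_sound h') _ _ (hxw.tail hwy))

/-- Every nonempty set of vertices contains a simplicial vertex of the undirected part. -/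
theorem exists_simplicial [Finite V] (h : IsEssential S G M) {W : Set V} (hW : W.Nonempty) :
    ∃ x ∈ W, ∀ y ∈ W, ∀ z ∈ W, M.Und y x → M.Und z x → y ≠ z → M.Und y z := by
  have hwf : WellFounded fun a b : V => TransGen G.Dir b a := by
    have : IsTrans V fun a b : V => TransGen G.Dir b a := ⟨fun _ _ _ h1 h2 => h2.trans h1⟩
    have : Std.Irrefl fun a b : V => TransGen G.Dir b a := ⟨fun a ha => by
      obtain ⟨b, hab, hba⟩ := TransGen.head'_iff.1 ha
      exact h.mvr.not_reflTransGen_of_dir hab (reflTransGen_head_of_dir hba)⟩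
    exact Finite.wellFounded_of_trans_of_irrefl _
  -- Minimal for this relation means having no proper `G`-descendant in `W`, so `G` has arrowheads
  -- at `x` on all its undirected edges of `M` within `W`.
  obtain ⟨x, hx, hmin⟩ := hwf.has_min W hW
  have hhead : ∀ y ∈ W, M.Und y x → G.head y x := fun y hy hyx => by
    by_contra hcon
    refine hmin y hy (.single (h.mvr.dir_of_not_head ?_ hcon))
    rw [← h.skel]
    exact hyx.1.symm
  refine ⟨x, hx, fun y hy z hz hyx hzx hne => h.und_of_und_und hyx hzx ?_⟩
  by_contra hn
  exact hyx.2.1 (h.head_of_collider hne hn (hhead y hy hyx) (hhead z hz hzx))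

end IsEssential

end StablePC

/-! ### Tie-breaking and trees given by parents -/

theorem Finite.exists_injective_nat_of_lt {α : Type*} [Finite α] (f : α → ℕ) :
    ∃ g : α → ℕ, Function.Injective g ∧ ∀ a b, f a < f b → g a < g b := by
  obtain ⟨n, ⟨e⟩⟩ := Finite.exists_equiv_fin α
  -- Lexicographic order by `f` and then by the enumeration: `e a < n`, so ties are broken without
  -- disturbing `f`.
  refine ⟨fun a => f a * n + e a, fun a b hab => ?_, fun a b hab => ?_⟩
  · have ha := (e a).2
    have hb := (e b).2
    have : (f a * n + e a) % n = (f b * n + e b) % n := congrArg (· % n) hab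
    rw [Nat.mul_add_mod_of_lt ha, Nat.mul_add_mod_of_lt hb] at this
    exact e.injective (Fin.ext this)
  · have ha := (e a).2
    calc f a * n + e a < (f a + 1) * n := by rw [add_mul]; omega
      _ ≤ f b * n := Nat.mul_le_mul_right n hab
      _ ≤ _ := Nat.le_add_right _ _

namespace SimpleGraph

variable {I : Type*}

/-- The graph that joins every vertex other than `r` to its parent. -/
def parentGraph (r : I) (p : I → I) (idx : I → ℕ) (hp : ∀ i, i ≠ r → idx (p i) < idx i) :
    SimpleGraph I where
  Adj i j := (i ≠ r ∧ p i = j) ∨ (j ≠ r ∧ p j = i)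
  symm := ⟨fun _ _ h => h.symm⟩
  loopless := ⟨fun i h => by
    rcases h with ⟨h, hi⟩ | ⟨h, hi⟩ <;>
    · have := hp i h
      rw [hi] at this
      omega⟩

theorem parentGraph_adj {r : I} {p : I → I} {idx : I → ℕ}
    {hp : ∀ i, i ≠ r → idx (p i) < idx i} {i : I} (hi : i ≠ r) :
    (parentGraph r p idx hp).Adj i (p i) := .inl ⟨hi, rfl⟩

theorem parentGraph_connected (r : I) (p : I → I) (idx : I → ℕ)
    (hp : ∀ i, i ≠ r → idx (p i) < idx i) : (parentGraph r p idx hp).Connected := by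
  have key : ∀ k i, idx i = k → (parentGraph r p idx hp).Reachable i r := by
    intro k
    induction k using Nat.strong_induction_on with
    | _ k ih =>
      rintro i rfl
      by_cases hi : i = r
      · rw [hi]
      · exact (parentGraph_adj hi).reachable.trans (ih _ (hp i hi) _ rfl)
  have : Nonempty I := ⟨r⟩
  exact ⟨fun i j => (key _ i rfl).trans (key _ j rfl).symm⟩

/-- Every edge joins some `i ≠ r` to `p i`, so a connected graph has at most one edge fewer than
vertices. -/
theorem parentGraph_isTree [Finite I] (r : I) (p : I → I) (idx : I → ℕ)
    (hp : ∀ i, i ≠ r → idx (p i) < idx i) : (parentGraph r p idx hp).IsTree := by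
  have hc := parentGraph_connected r p idx hp
  rw [isTree_iff_connected_and_card]
  refine ⟨hc, le_antisymm ?_ hc.card_vert_le_card_edgeSet_add_one⟩
  have hsub : (parentGraph r p idx hp).edgeSet ⊆ (fun i => s(i, p i)) '' {r}ᶜ := by
    intro e
    induction e with
    | _ a b =>
      rintro (⟨h, e⟩ | ⟨h, e⟩)
      · exact ⟨a, h, congrArg (fun x => s(a, x)) e⟩
      · exact ⟨b, h, (congrArg (fun x => s(b, x)) e).trans Sym2.eq_swap⟩
  have h1 : (parentGraph r p idx hp).edgeSet.ncard ≤ ({r}ᶜ : Set I).ncard :=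
    (Set.ncard_le_ncard hsub (Set.toFinite _)).trans (Set.ncard_image_le (Set.toFinite _))
  have h2 := Set.ncard_add_ncard_compl ({r} : Set I)
  rw [Set.ncard_singleton] at h2
  rw [Nat.card_coe_set_eq]
  omega

theorem IsAcyclic.eq_of_isPath {T : SimpleGraph I} (hT : T.IsAcyclic) {a b : I}
    {p q : T.Walk a b} (hp : p.IsPath) (hq : q.IsPath) : p = q :=
  congrArg Subtype.val ((hT.subsingleton_path a b).elim ⟨p, hp⟩ ⟨q, hq⟩)

theorem IsTree.length_eq_dist {T : SimpleGraph I} (hT : T.IsTree) {a b : I}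
    {p : T.Walk a b} (hp : p.IsPath) : p.length = T.dist a b := by
  obtain ⟨q, hq⟩ := hT.1.exists_walk_length_eq_dist a b
  rw [hT.2.eq_of_isPath hp (q.isPath_of_length_eq_dist hq), hq]

theorem IsAcyclic.support_subset {T : SimpleGraph I} (hT : T.IsAcyclic) {a b : I}
    {p : T.Walk a b} (hp : p.IsPath) (q : T.Walk a b) : p.support ⊆ q.support := by
  classical
  rw [hT.eq_of_isPath hp q.bypass_isPath]
  exact q.support_bypass_subset_support

end SimpleGraph

/-! ### Junction trees and perfect orders -/

namespace StablePC

open SimpleGraph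

variable {V : Type*} {U : SimpleGraph V}

theorem exists_clique_superset [Finite V] {D : Set V} (hD : U.IsClique D) :
    ∃ C : Clique U, D ⊆ C.1 := by
  obtain ⟨C, hDC, hC⟩ := Set.Finite.exists_le_maximal (s := {C | U.IsClique C}) (Set.toFinite _) hD
  exact ⟨⟨C, hC⟩, hDC⟩

/-- A clique enumeration with the running intersection property: `C 0, …, C n` are
the maximal cliques inside `W`, and each meets the union of its predecessors in a subset of one of them. -/
structure RunningIntersection (U : SimpleGraph V) (W : Set V) (n : ℕ) (C : ℕ → Set V)
    (par : ℕ → ℕ) : Prop where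
  subset : ∀ i ≤ n, C i ⊆ W
  isClique : ∀ i ≤ n, U.IsClique (C i)
  cover : ∀ D ⊆ W, U.IsClique D → ∃ i ≤ n, D ⊆ C i
  antichain : ∀ i ≤ n, ∀ j ≤ n, C i ⊆ C j → i = j
  par_lt : ∀ j, 0 < j → j ≤ n → par j < j
  inter_subset : ∀ i j, i < j → j ≤ n → C i ∩ C j ⊆ C (par j)

theorem RunningIntersection.exists_insert {W : Set V} {x : V} (hx : x ∉ W)
    (hs : ∀ y ∈ W, ∀ z ∈ W, U.Adj y x → U.Adj z x → y ≠ z → U.Adj y z) {n : ℕ} {C : ℕ → Set V}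
    {par : ℕ → ℕ} (h : RunningIntersection U W n C par) :
    ∃ n C par, RunningIntersection U (insert x W) n C par := by
  set N : Set V := {y ∈ W | U.Adj y x} with hN
  have hNW : N ⊆ W := fun y hy => hy.1
  have hNc : U.IsClique N := fun y hy z hz hne => hs y hy.1 z hz.1 hy.2 hz.2 hne
  have hxN : U.IsClique (insert x N) :=
    (isClique_insert).2 ⟨hNc, fun y hy _ => hy.2.symm⟩
  have hcov : ∀ D ⊆ insert x W, U.IsClique D → x ∈ D → D ⊆ insert x N := by
    intro D hD hDc hxD y hy
    by_cases hyx : y = x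
    · exact .inl hyx
    · exact .inr ⟨(hD hy).resolve_left hyx, hDc hy hxD hyx⟩
  have hcov' : ∀ D ⊆ insert x W, x ∉ D → D ⊆ W := by
    intro D hD hxD y hy
    refine (hD hy).resolve_left ?_
    rintro rfl
    exact hxD hy
  have hxC : ∀ i ≤ n, x ∉ C i := fun i hi hxi => hx (h.subset i hi hxi)
  obtain ⟨k, hk, hNk⟩ := h.cover N hNW hNc
  -- If the neighbourhood `N` is a clique of the list, `x` is added to that clique. Otherwise `N`
  -- with `x` becomes a new last clique with parent `k`.
  by_cases hkN : C k ⊆ N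
  · have hkN' : C k = N := hkN.antisymm hNk
    set C' := Function.update C k (insert x N) with hC'
    have e0 : C' k = insert x N := Function.update_self _ _ _
    have e1 : ∀ i, i ≠ k → C' i = C i := fun i hi => Function.update_of_ne hi _ _
    have hle : ∀ i, C i ⊆ C' i := fun i => by
      by_cases hi : i = k
      · rw [hi, e0, hkN']
        exact Set.subset_insert _ _
      · rw [e1 i hi]
    have hge : ∀ i, ∀ y ∈ C' i, y ≠ x → y ∈ C i := fun i y hy hyx => by
      by_cases hi : i = k
      · subst hi
        rw [e0] at hy
        rw [hkN']
        exact hy.resolve_left hyx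
      · rwa [e1 i hi] at hy
    have hxk : ∀ i ≤ n, x ∈ C' i → i = k := fun i hi hxi => by
      by_contra hne
      rw [e1 i hne] at hxi
      exact hxC i hi hxi
    refine ⟨n, C', par, ?_, ?_, ?_, ?_, h.par_lt, ?_⟩
    · intro i hi y hy
      by_cases hyx : y = x
      · exact .inl hyx
      · exact .inr (h.subset i hi (hge i y hy hyx))
    · intro i hi
      by_cases hik : i = k
      · rwa [hik, e0]
      · rw [e1 i hik]
        exact h.isClique i hi
    · intro D hD hDc
      by_cases hxD : x ∈ D
      · exact ⟨k, hk, e0 ▸ hcov D hD hDc hxD⟩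
      · obtain ⟨i, hi, hDi⟩ := h.cover D (hcov' D hD hxD) hDc
        exact ⟨i, hi, hDi.trans (hle i)⟩
    · intro i hi j hj hij
      by_cases hik : i = k
      · refine hik.trans (hxk j hj (hij ?_)).symm
        rw [hik, e0]
        exact Set.mem_insert _ _
      · refine h.antichain i hi j hj fun y hy => hge j y (hij (hle i hy)) ?_
        rintro rfl
        exact hxC i hi hy
    · rintro i j hij hj y ⟨hyi, hyj⟩
      have hyx : y ≠ x := by
        rintro rfl
        exact hij.ne ((hxk i (by omega) hyi).trans (hxk j hj hyj).symm)
      exact hle _ (h.inter_subset i j hij hj ⟨hge i y hyi hyx, hge j y hyj hyx⟩)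
  · set C' := Function.update C (n + 1) (insert x N) with hC'
    have e0 : C' (n + 1) = insert x N := Function.update_self _ _ _
    have e1 : ∀ i ≤ n, C' i = C i := fun i hi => Function.update_of_ne (by omega) _ _
    have p0 : Function.update par (n + 1) k (n + 1) = k := Function.update_self _ _ _
    have p1 : ∀ i ≤ n, Function.update par (n + 1) k i = par i := fun i hi =>
      Function.update_of_ne (by omega) _ _
    have hcase : ∀ i ≤ n + 1, i ≤ n ∨ i = n + 1 := fun i hi => by omega
    refine ⟨n + 1, C', Function.update par (n + 1) k, ?_, ?_, ?_, ?_, ?_, ?_⟩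
    · intro i hi
      rcases hcase i hi with hi | rfl
      · rw [e1 i hi]
        exact (h.subset i hi).trans (Set.subset_insert _ _)
      · rw [e0]
        exact Set.insert_subset_insert hNW
    · intro i hi
      rcases hcase i hi with hi | rfl
      · rw [e1 i hi]
        exact h.isClique i hi
      · rwa [e0]
    · intro D hD hDc
      by_cases hxD : x ∈ D
      · exact ⟨n + 1, le_rfl, e0 ▸ hcov D hD hDc hxD⟩
      · obtain ⟨i, hi, hDi⟩ := h.cover D (hcov' D hD hxD) hDc
        exact ⟨i, by omega, by rwa [e1 i hi]⟩
    · intro i hi j hj hij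
      rcases hcase i hi with hi | rfl
      · rcases hcase j hj with hj | rfl
        · rw [e1 i hi, e1 j hj] at hij
          exact h.antichain i hi j hj hij
        · rw [e1 i hi, e0] at hij
          have hiN : C i ⊆ N := fun y hy => (hij hy).resolve_left (by
            rintro rfl
            exact hxC i hi hy)
          obtain rfl := h.antichain i hi k hk (hiN.trans hNk)
          exact absurd hiN hkN
      · rcases hcase j hj with hj | rfl
        · rw [e0, e1 j hj] at hij
          exact absurd (hij (Set.mem_insert _ _)) (hxC j hj)
        · rfl
    · intro j h0 hj
      rcases hcase j hj with hj | rfl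
      · rw [p1 j hj]
        exact h.par_lt j h0 hj
      · rw [p0]
        omega
    · intro i j hij hj
      rcases hcase j hj with hj | rfl
      · rw [p1 j hj, e1 i (by omega), e1 j hj, e1 _ (by have := h.par_lt j (by omega) hj; omega)]
        exact h.inter_subset i j hij hj
      · rw [p0, e1 i (by omega), e0, e1 k hk]
        rintro y ⟨hyi, hy⟩
        refine hNk (hy.resolve_left ?_)
        rintro rfl
        exact hxC i (by omega) hyi

theorem exists_runningIntersection [Finite V]
    (hs : ∀ W : Set V, W.Nonempty → ∃ x ∈ W, ∀ y ∈ W, ∀ z ∈ W, U.Adj y x → U.Adj z x → y ≠ z →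
      U.Adj y z) (W : Set V) : ∃ n C par, RunningIntersection U W n C par := by
  generalize hk : W.ncard = k
  induction k generalizing W with
  | zero =>
    rw [Set.ncard_eq_zero] at hk
    subst hk
    -- The empty set counts as the one maximal clique here, so the list is never empty, even when
    -- there are no vertices.
    refine ⟨0, fun _ => ∅, id, by simp, by simp, fun D hD _ => ⟨0, le_rfl, hD⟩, ?_, ?_, by simp⟩
    · intro i hi j hj _
      omega
    · intro j h0 hj
      omega
  | succ k ih =>
    obtain ⟨x, hx, hxs⟩ := hs W (by
      rw [← Set.ncard_pos]
      omega)
    have hW : insert x (W \ {x}) = W := by simp [hx]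
    have hcard : (W \ {x}).ncard = k := by
      have := Set.ncard_sdiff_singleton_add_one hx
      omega
    obtain ⟨n, C, par, h⟩ := ih _ hcard
    have := h.exists_insert (x := x) (by simp) fun y hy z hz => hxs y hy.1 z hz.1
    rwa [hW] at this

theorem exists_isJunctionTree [Finite V]
    (hs : ∀ W : Set V, W.Nonempty → ∃ x ∈ W, ∀ y ∈ W, ∀ z ∈ W, U.Adj y x → U.Adj z x → y ≠ z →
      U.Adj y z) : ∃ T : SimpleGraph (Clique U), IsJunctionTree U T := by
  obtain ⟨n, C, par, h⟩ := exists_runningIntersection hs Set.univ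
  have hmax : ∀ i ≤ n, Maximal U.IsClique (C i) := fun i hi =>
    ⟨h.isClique i hi, fun D hD hCD => by
      obtain ⟨j, hj, hDj⟩ := h.cover D (Set.subset_univ _) hD
      obtain rfl := h.antichain i hi j hj (hCD.trans hDj)
      exact hDj⟩
  have hidx : ∀ D : Clique U, ∃ i ≤ n, C i = D.1 := fun D => by
    obtain ⟨i, hi, hDi⟩ := h.cover D.1 (Set.subset_univ _) D.2.1
    exact ⟨i, hi, (D.2.2 (h.isClique i hi) hDi).antisymm hDi⟩
  choose idx hle hidx using hidx
  have hsurj : ∀ i ≤ n, ∃ D : Clique U, idx D = i := fun i hi =>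
    ⟨⟨C i, hmax i hi⟩, h.antichain _ (hle _) i hi (hidx _).le⟩
  have hinj : Function.Injective idx := fun D E hDE =>
    Subtype.ext (by rw [← hidx D, ← hidx E, hDE])
  obtain ⟨r, hr⟩ := hsurj 0 (by omega)
  have hpos : ∀ D, D ≠ r → 0 < idx D := fun D hD => by
    refine Nat.pos_of_ne_zero fun h0 => hD (hinj (h0.trans hr.symm))
  have hpar : ∀ D : Clique U, ∃ P : Clique U, D ≠ r → idx P = par (idx D) := fun D => by
    by_cases hD : D = r
    · exact ⟨r, fun h' => absurd hD h'⟩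
    · have := h.par_lt _ (hpos D hD) (hle D)
      obtain ⟨P, hP⟩ := hsurj (par (idx D)) (this.le.trans (hle D))
      exact ⟨P, fun _ => hP⟩
  choose p hp using hpar
  have hlt : ∀ D, D ≠ r → idx (p D) < idx D := fun D hD => by
    rw [hp D hD]
    exact h.par_lt _ (hpos D hD) (hle D)
  have hT := parentGraph_isTree r p idx hlt
  refine ⟨_, hT, fun D E w hw K hK x hx => ?_⟩
  obtain ⟨m, hxm, hmin⟩ : ∃ m : Clique U, x ∈ m.1 ∧ ∀ D : Clique U, x ∈ D.1 → idx m ≤ idx D := by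
    obtain ⟨m, hm, hmin⟩ := (measure idx).wf.has_min {D : Clique U | x ∈ D.1} ⟨D, hx.1⟩
    exact ⟨m, hm, fun D' hD' => not_lt.1 (hmin D' hD')⟩
  -- By running intersection, passing to parents from a clique containing `x` stays among such
  -- cliques until the one of least index. In a tree, the path between two cliques is contained in
  -- any walk between them, here the one through `m`.
  have key : ∀ k, ∀ D : Clique U, idx D = k → x ∈ D.1 →
      ∃ q : (parentGraph r p idx hlt).Walk D m, ∀ L ∈ q.support, x ∈ L.1 := by
    intro k
    induction k using Nat.strong_induction_on with
    | _ k ih =>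
      rintro D rfl hxD
      by_cases hDm : D = m
      · subst hDm
        exact ⟨.nil, by simpa using hxD⟩
      · have hlt' : idx m < idx D := lt_of_le_of_ne (hmin D hxD) fun he => hDm (hinj he).symm
        have hDr : D ≠ r := by
          rintro rfl
          omega
        have hxp : x ∈ (p D).1 := by
          rw [← hidx, hp D hDr]
          refine h.inter_subset _ _ hlt' (hle D) ⟨?_, ?_⟩
          · rwa [hidx]
          · rwa [hidx]
        obtain ⟨q, hq⟩ := ih _ (hlt D hDr) _ rfl hxp
        refine ⟨.cons (parentGraph_adj hDr) q, fun L hL => ?_⟩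
        rw [Walk.support_cons, List.mem_cons] at hL
        rcases hL with rfl | hL
        · exact hxD
        · exact hq L hL
  obtain ⟨q1, h1⟩ := key _ D rfl hx.1
  obtain ⟨q2, h2⟩ := key _ E rfl hx.2
  have hK' := hT.2.support_subset hw (q1.append q2.reverse) hK
  rw [Walk.mem_support_append_iff, Walk.support_reverse, List.mem_reverse] at hK'
  exact hK'.elim (h1 K) (h2 K)

/-- In a junction tree the clique containing `x` that is closest to `A` lies on every path from `A`
to a clique containing `x`. -/
theorem IsJunctionTree.mem_support {T : SimpleGraph (Clique U)} (hT : IsJunctionTree U T) {x : V}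
    {A D F : Clique U} (w : T.Walk A D) (hw : w.IsPath) (hD : x ∈ D.1) (hF : x ∈ F.1)
    (hmin : ∀ X : Clique U, x ∈ X.1 → T.dist A F ≤ T.dist A X) : F ∈ w.support := by
  induction w with
  | @nil D =>
    have := hmin D hD
    rw [dist_self, Nat.le_zero, hT.1.1.dist_eq_zero_iff] at this
    simp [this]
  | @cons A B D hAB w ih =>
    rw [Walk.cons_isPath_iff] at hw
    by_cases hA : x ∈ A.1
    · have := hmin A hA
      rw [dist_self, Nat.le_zero, hT.1.1.dist_eq_zero_iff] at this
      simp [this]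
    -- The path from `A` to any such `X` starts with the edge to `B`: otherwise `A` would lie
    -- between `D` and `X` and so contain `x`.
    · have hd : ∀ X : Clique U, x ∈ X.1 → T.dist A X = T.dist B X + 1 := by
        intro X hX
        obtain ⟨q, hq⟩ := hT.1.1.exists_walk_length_eq_dist B X
        have hqp := q.isPath_of_length_eq_dist hq
        obtain ⟨q', hq'⟩ := hT.1.1.exists_walk_length_eq_dist D X
        have hqp' := q'.isPath_of_length_eq_dist hq'
        have hAq : A ∉ q.support := fun h' => by
          have := hT.1.2.support_subset hqp (w.append q') h'
          rw [Walk.mem_support_append_iff] at this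
          exact this.elim hw.2 fun h'' => hA (hT.2 D X q' hqp' A h'' ⟨hD, hX⟩)
        have := hT.1.length_eq_dist ((Walk.cons_isPath_iff hAB q).2 ⟨hqp, hAq⟩)
        rw [← this, Walk.length_cons, hq]
      have := ih hw.1 hD fun X hX => by
        have := hmin X hX
        rw [hd F hF, hd X hX] at this
        omega
      simp [this]

theorem exists_first_clique [Finite V] (rank : Clique U → ℕ) (x : V) :
    ∃ F : Clique U, x ∈ F.1 ∧ ∀ D : Clique U, x ∈ D.1 → rank F ≤ rank D := by
  obtain ⟨C, hC⟩ := exists_clique_superset (U := U) (D := {x}) (by simp)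
  obtain ⟨F, hF, hmin⟩ :=
    (measure rank).wf.has_min {D : Clique U | x ∈ D.1} ⟨C, hC (Set.mem_singleton x)⟩
  exact ⟨F, hF, fun D hD => not_lt.1 (hmin D hD)⟩

/-- A node order derived from a junction tree is a perfect order. -/
theorem IsNodeOrder.adj [Finite V] {T : SimpleGraph (Clique U)} (hT : IsJunctionTree U T)
    {root : Clique U} {rank : Clique U → ℕ} (hr : IsCliqueOrder T root rank) {pos : V → ℕ}
    (hp : IsNodeOrder rank pos) {a b c : V} (hac : U.Adj a c) (hbc : U.Adj b c)
    (ha : pos a < pos c) (hb : pos b < pos c) (hab : a ≠ b) : U.Adj a b := by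
  classical
  obtain ⟨C, hcC, hC⟩ := exists_first_clique rank c
  -- The clique of least rank containing `x` is also one of those closest to the root.
  have hdist : ∀ {F : Clique U} {x : V}, (∀ D : Clique U, x ∈ D.1 → rank F ≤ rank D) →
      ∀ X : Clique U, x ∈ X.1 → T.dist root F ≤ T.dist root X := fun hF X hX => by
    by_contra! hlt
    exact absurd (hF X hX) (not_le.2 (hr.2 _ _ hlt))
  have key : ∀ a, U.Adj a c → pos a < pos c → a ∈ C.1 := by
    intro a hac ha
    obtain ⟨A, haA, hA⟩ := exists_first_clique rank a
    have hrank : rank A ≤ rank C := by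
      by_contra! hlt
      exact absurd (hp.2 c a ⟨C, hcC, fun D hD => hlt.trans_le (hA D hD)⟩) (not_lt.2 ha.le)
    have hAC : T.dist root A ≤ T.dist root C := by
      by_contra! hlt
      exact absurd (hr.2 _ _ hlt) (not_lt.2 hrank)
    obtain ⟨D, hD⟩ := exists_clique_superset (U := U) (D := {a, c})
      (by simp [hac])
    obtain ⟨w, hw⟩ := hT.1.1.exists_walk_length_eq_dist root D
    have hwp := w.isPath_of_length_eq_dist hw
    have hAw := hT.mem_support w hwp (hD (by simp)) haA (hdist hA)
    have hCw := hT.mem_support w hwp (hD (by simp)) hcC (hdist hC)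
    have hCw' := hCw
    rw [← w.take_spec hAw, Walk.mem_support_append_iff] at hCw'
    -- The first cliques `A` of `a` and `C` of `c` both lie on the path from the root to a clique
    -- `D` containing both vertices. If `C` comes no later than `A`, equality of distances gives `C
    -- = A`; otherwise `C` is between `A` and `D` and contains `a`.
    rcases hCw' with h' | h'
    · have e1 := hT.1.length_eq_dist (hwp.takeUntil hAw)
      have e2 := hT.1.length_eq_dist ((hwp.takeUntil hAw).takeUntil h')
      have e3 := congrArg Walk.length ((w.takeUntil A hAw).take_spec h')
      rw [Walk.length_append] at e3
      have : ((w.takeUntil A hAw).dropUntil C h').length = 0 := by omega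
      rw [Walk.eq_of_length_eq_zero this]
      exact haA
    · exact hT.2 A D _ (hwp.dropUntil hAw) C h' ⟨haA, hD (by simp)⟩
  exact C.2.1 (key a hac ha) (key b hbc hb) hab

theorem exists_isNodeOrder [Finite V] (rank : Clique U → ℕ) : ∃ pos, IsNodeOrder rank pos := by
  choose F hF hmin using exists_first_clique rank
  obtain ⟨pos, hinj, hpos⟩ := Finite.exists_injective_nat_of_lt fun x => rank (F x)
  refine ⟨pos, hinj, fun a b ⟨C, haC, hC⟩ => hpos a b ?_⟩
  exact (hmin a C haC).trans_lt (hC _ (hF b))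

end StablePC

/-! ### Orientation of the undirected part and correctness of the output -/

namespace StablePC

open MixedGraph Relation

variable {V : Type*} {G K M : MixedGraph V} {S : V → V → Option (Finset V)} {pos : V → ℕ}

theorem bi_of_bi_orientUnd {a b : V} (hab : (orientUnd M pos).Bi a b) :
    M.Bi a b := by
  obtain ⟨h1 | ⟨h1, h1'⟩, h2 | ⟨h2, h2'⟩⟩ := hab
  · exact ⟨h1, h2⟩
  · exact absurd h1 h2.2.2
  · exact absurd h2 h1.2.2
  · omega

namespace IsEssential

/-- Steps along formerly undirected edges are absorbed, since arrowheads propagate along them. A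
returning walk would thus give one in `M` itself. -/
theorem not_reflTransGen_orientUnd_of_dir (h : IsEssential S G M) {a b : V} (hd : M.Dir a b) :
    ¬ ReflTransGen (orientUnd M pos).head b a := by
  have key : ∀ z, ReflTransGen (orientUnd M pos).head b z →
      M.Dir a z ∨ ∃ b', M.Dir a b' ∧ TransGen M.head b' z := by
    intro z hz
    induction hz with
    | refl => exact .inl hd
    | tail _ hzw ih =>
      rcases hzw with hzw | ⟨hzw, -⟩
      · rcases ih with ih | ⟨b', hb', ih⟩
        · exact .inr ⟨_, ih, .single hzw⟩
        · exact .inr ⟨b', hb', ih.tail hzw⟩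
      · rcases ih with ih | ⟨b', hb', ih⟩
        · exact .inl (h.dir_of_dir_und ih hzw)
        · refine .inr ⟨b', hb', ?_⟩
          obtain ⟨y, hy, hyz⟩ := TransGen.tail'_iff.1 ih
          exact TransGen.tail'_iff.2 ⟨y, hy, h.head_of_head_und hyz hzw⟩
  intro hw
  rcases key a hw with h' | ⟨b', hb', h'⟩
  · exact not_head_self _ h'.1
  · exact h.not_transGen_of_dir hb' h'.to_reflTransGen

/-- As long as the walk uses only formerly undirected edges, `pos` does not decrease. The first
other step is a directed edge of `M` by `dir_of_und_head`, and directed edges of `M` lie on no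
closed arrowhead walk. -/
theorem not_reflTransGen_orientUnd_of_und (h : IsEssential S G M) {a b : V} (hab : M.Und a b)
    (hpos : pos a < pos b) : ¬ ReflTransGen (orientUnd M pos).head b a := by
  have key : ∀ z, ReflTransGen (orientUnd M pos).head b z →
      (pos b ≤ pos z ∧ ∃ y, M.Und y z) ∨ ∃ y x, M.Dir y x ∧
        ReflTransGen (orientUnd M pos).head b y ∧ ReflTransGen (orientUnd M pos).head x z := by
    intro z hz
    induction hz with
    | refl => exact .inl ⟨le_rfl, a, hab⟩
    | tail hbz hzw ih =>
      rcases ih with ⟨h1, y, hy⟩ | ⟨y, x, hyx, h1, h2⟩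
      · rcases hzw with hzw | ⟨hzw, hlt⟩
        · exact .inr ⟨_, _, h.dir_of_und_head hy hzw, hbz, .refl⟩
        · exact .inl ⟨h1.trans hlt.le, _, hzw⟩
      · exact .inr ⟨y, x, hyx, h1, h2.tail hzw⟩
  intro hw
  rcases key a hw with ⟨h', -⟩ | ⟨y, x, hyx, h1, h2⟩
  · omega
  · exact h.not_reflTransGen_orientUnd_of_dir hyx ((h2.tail (.inr ⟨hab, hpos⟩)).trans h1)

theorem isMVRChainGraph_orientUnd (h : IsEssential S G M) (hinj : Function.Injective pos) :
    (orientUnd M pos).IsMVRChainGraph := by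
  refine isMVRChainGraph_of_not_reflTransGen ?_ ?_
  · rintro a b ⟨hab, h1, h2⟩
    have hu : M.Und a b := ⟨hab, fun h' => h1 (.inl h'), fun h' => h2 (.inl h')⟩
    rcases lt_trichotomy (pos a) (pos b) with hlt | heq | hlt
    · exact h1 (.inr ⟨hu, hlt⟩)
    · exact M.skel.ne_of_adj hab (hinj heq)
    · exact h2 (.inr ⟨⟨hab.symm, hu.2.2, hu.2.1⟩, hlt⟩)
  · rintro a b ⟨hab | ⟨hab, hpos⟩, hba⟩
    · exact h.not_reflTransGen_orientUnd_of_dir ⟨hab, fun h' => hba (.inl h')⟩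
    · exact h.not_reflTransGen_orientUnd_of_und hab hpos

theorem sameColliders_orientUnd (h : IsEssential S G M)
    (hperf : ∀ a b c, M.Und a c → M.Und b c → pos a < pos c → pos b < pos c → a ≠ b → M.Und a b) :
    (orientUnd M pos).SameColliders G := by
  refine ⟨fun a b => by rw [← h.skel]; rfl, fun x w y hxy hn h1 h2 => ⟨?_, ?_⟩⟩
  -- A collider formed by an arrowhead of `M` and a newly oriented edge is shielded by propagation;
  -- one formed by two new edges is shielded because the order is perfect.
  · have hmix : ∀ x y, x ≠ y → ¬ M.skel.Adj x y → M.head y w → ¬ M.Und x w := by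
      intro x y hxy hn hy hx
      exact hn (h.adj_of_head_und hy ⟨hx.1.symm, hx.2.2, hx.2.1⟩).symm
    rintro ⟨hx | ⟨hx, hxp⟩, hy | ⟨hy, hyp⟩⟩
    · exact ⟨h.head_sound hx, h.head_sound hy⟩
    · exact absurd hy (hmix y x hxy.symm (fun h' => hn h'.symm) hx)
    · exact absurd hx (hmix x y hxy hn hy)
    · exact absurd (hperf x y w hx hy hxp hyp hxy).1 hn
  · rintro ⟨hx, hy⟩
    exact ⟨.inl (h.head_of_collider hxy hn hx hy),
      .inl (h.head_of_collider hxy.symm (fun h' => hn h'.symm) hy hx)⟩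

end IsEssential

/-- The properties of the output graph that the correctness of the algorithm requires. -/
def IsCorrectOutput (G G' : MixedGraph V) : Prop :=
  G'.IsMVRChainGraph ∧ G'.MarkovEquivalent G ∧
    ∀ K : MixedGraph V, K.IsMVRChainGraph → K.MarkovEquivalent G → ∀ a b, G'.Bi a b → K.Bi a b

theorem IsEssential.isCorrectOutput [Fintype V] (h : IsEssential S G M)
    {T : SimpleGraph (Clique (undPart M))} (hT : IsJunctionTree (undPart M) T)
    {root : Clique (undPart M)} {rank : Clique (undPart M) → ℕ} (hr : IsCliqueOrder T root rank)
    (hp : IsNodeOrder rank pos) : IsCorrectOutput G (orientUnd M pos) := by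
  have hmvr := h.isMVRChainGraph_orientUnd hp.1
  refine ⟨hmvr, (h.sameColliders_orientUnd fun a b c hac hbc ha hb hab =>
    hp.adj hT hr hac hbc ha hb hab).markovEquivalent hmvr h.mvr, fun K hK hKG a b hab => ?_⟩
  have hSK := h.sep.of_markovEquivalent h.mvr hK hKG
  have hbi := bi_of_bi_orientUnd hab
  unfold MixedGraph.Bi at hbi
  rw [h.head_iff, h.head_iff, ← skel_eq_of_markovEquivalent h.mvr hK hKG] at hbi
  exact ⟨hbi.1.head hSK hK, hbi.2.head hSK hK⟩

theorem IsEssential.exists_junctionTree [Finite V] (h : IsEssential S G M) :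
    ∃ T, IsJunctionTree (undPart M) T :=
  exists_isJunctionTree fun _ hW => h.exists_simplicial hW

/-! ### Invariants of the skeleton and orientation phases -/

/-- The invariant of the skeleton phase. -/
structure SkelInv (G : MixedGraph V) (i : ℕ) (A H : SimpleGraph V)
    (S : V → V → Option (Finset V)) : Prop where
  le : G.skel ≤ H
  le_stored : H ≤ A
  sep : ∀ {u v T}, S u v = some T →
    u ≠ v ∧ ¬ H.Adj u v ∧ u ∉ T ∧ v ∉ T ∧ G.MSep {u} {v} T
  comm : ∀ u v, S u v = S v u
  total : ∀ {u v}, u ≠ v → ¬ H.Adj u v → ∃ T, S u v = some T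
  level : ∀ {u v T}, H.Adj u v → (∀ x ∈ T, G.skel.Adj u x ∧ x ≠ v) → G.MSep {u} {v} T →
    i ≤ T.card

theorem SkelInv.init (G : MixedGraph V) : SkelInv G 0 ⊤ ⊤ fun _ _ => none where
  le := le_top
  le_stored := le_rfl
  sep h := by simp at h
  comm _ _ := rfl
  total hne hn := absurd ((SimpleGraph.top_adj _ _).2 hne) hn
  level _ _ _ := Nat.zero_le _

/-- The queries are answered according to `m`-separation in `G`. -/
def IsPerfectTest (G : MixedGraph V) (test : V → V → Finset V → Prop) : Prop :=
  ∀ u v T, u ≠ v → u ∉ T → v ∉ T → (test u v T ↔ G.MSep {u} {v} T)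

variable {test : V → V → Finset V → Prop} {i : ℕ} {A H : SimpleGraph V}

theorem SkelInv.remove (hG : G.IsMVRChainGraph) (ht : IsPerfectTest G test)
    (h : SkelInv G i A H S) {u v : V} {T : Finset V} (hc : CanRemove test i A H u v T) :
    SkelInv G i A (H.deleteEdges {s(u, v)}) (setSep S u v T) := by
  obtain ⟨hH, -, hT, -, htest⟩ := hc
  have hu : u ∉ T := fun h' => A.irrefl (hT u h').1
  have hv : v ∉ T := fun h' => (hT v h').2 rfl
  have hsep := (ht u v T hH.ne hu hv).1 htest
  have hadj : ∀ x y, (H.deleteEdges {s(u, v)}).Adj x y ↔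
      H.Adj x y ∧ ¬ ((x = u ∧ y = v) ∨ (x = v ∧ y = u)) := by
    intro x y
    simp [SimpleGraph.deleteEdges_adj]
  refine ⟨?_, ?_, ?_, ?_, ?_, ?_⟩
  · intro x y hxy
    rw [hadj]
    refine ⟨h.le hxy, ?_⟩
    rintro (⟨rfl, rfl⟩ | ⟨rfl, rfl⟩)
    · exact not_mSep_of_adj hxy hu hv hsep
    · exact not_mSep_of_adj hxy.symm hu hv hsep
  · exact (SimpleGraph.deleteEdges_le _).trans h.le_stored
  · intro x y T' hxy
    rw [hadj]
    unfold setSep at hxy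
    split_ifs at hxy with hc
    · obtain rfl := Option.some.inj hxy
      suffices h1 : x ≠ y ∧ x ∉ T ∧ y ∉ T ∧ G.MSep {x} {y} T from
        ⟨h1.1, fun h2 => h2.2 hc, h1.2⟩
      rcases hc with ⟨rfl, rfl⟩ | ⟨rfl, rfl⟩
      · exact ⟨hH.ne, hu, hv, hsep⟩
      · exact ⟨hH.ne', hv, hu, hsep.symm hG (admissibleTriple_singleton hH.ne hu hv)⟩
    · obtain ⟨h1, h2, h3⟩ := h.sep hxy
      exact ⟨h1, fun h' => h2 h'.1, h3⟩
  · intro x y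
    unfold setSep
    rw [h.comm x y]
    congr 1
    exact propext (by tauto)
  · intro x y hxy hn
    unfold setSep
    split_ifs with hc
    · exact ⟨T, rfl⟩
    · exact h.total hxy fun h' => hn ((hadj x y).2 ⟨h', hc⟩)
  · intro x y T' hxy h1 h2
    exact h.level ((hadj x y).1 hxy).1 h1 h2

/-- Neighbours in `G` always belong to the stored sets, so a separator of size `i` consisting of
them could still be selected. -/
theorem SkelInv.nextLevel (ht : IsPerfectTest G test) (h : SkelInv G i A H S)
    (hn : ∀ u v T, ¬ CanRemove test i A H u v T) : SkelInv G (i + 1) H H S where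
  le := h.le
  le_stored := le_rfl
  sep := h.sep
  comm := h.comm
  total := h.total
  level {u v T} hH hT hs := by
    refine Nat.lt_of_le_of_ne (h.level hH hT hs) fun he => hn u v T ?_
    refine ⟨hH, h.le_stored hH, fun x hx => ⟨h.le_stored (h.le (hT x hx).1), (hT x hx).2⟩,
      he.symm, (ht u v T hH.ne ?_ ?_).2 hs⟩
    · exact fun h' => G.skel.irrefl (hT u h').1
    · exact fun h' => (hT v h').2 rfl

/-- A surplus edge would join two vertices separated by the parents of one of them. These are at
most `|V| - 2` vertices, a size covered by the completed levels. -/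
theorem SkelInv.eq_skel [Fintype V] (hG : G.IsMVRChainGraph) (h : SkelInv G i A H S)
    (hi : ¬ i + 2 ≤ Fintype.card V) : H = G.skel := by
  classical
  refine le_antisymm (fun u v ha => ?_) h.le
  by_contra hn
  wlog hs : ¬ G.SemiDesc u v generalizing u v
  · exact this v u ha.symm (fun h' => hn h'.symm) (hG.not_semiDesc (not_not.1 hs))
  have hsep := hG.mSep_parents ha.ne hn hs (Z := Finset.univ.filter fun x => G.Dir x u) (by simp)
  have hmem : ∀ x ∈ Finset.univ.filter fun x => G.Dir x u, G.skel.Adj u x ∧ x ≠ v := by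
    intro x hx
    have hxu := (G.adj_of_head _ _ (Finset.mem_filter.1 hx).2.1).symm
    exact ⟨hxu, by rintro rfl; exact hn hxu⟩
  have hlevel := h.level ha hmem hsep
  have hsub : (Finset.univ.filter fun x => G.Dir x u) ⊆ (Finset.univ.erase u).erase v := by
    intro x hx
    have := hmem x hx
    simp [this.2, this.1.ne']
  have hcard := Finset.card_le_card hsub
  rw [Finset.card_erase_of_mem (by simp [ha.ne']), Finset.card_erase_of_mem (Finset.mem_univ _),
    Finset.card_univ] at hcard
  have : 1 < Fintype.card V := Fintype.one_lt_card_iff.2 ⟨u, v, ha.ne⟩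
  omega

theorem SkelInv.sepInfo (h : SkelInv G i A G.skel S) : SepInfo S G where
  ne hT := (h.sep hT).1
  not_adj hT := (h.sep hT).2.1
  notMem_left hT := (h.sep hT).2.2.1
  notMem_right hT := (h.sep hT).2.2.2.1
  mSep hT := (h.sep hT).2.2.2.2
  comm := h.comm
  total := h.total

/-- The invariant of the orientation phase. -/
structure OrientInv (G : MixedGraph V) (S : V → V → Option (Finset V)) (M : MixedGraph V) :
    Prop where
  sep : SepInfo S G
  skel : M.skel = G.skel
  vStructure : ∀ {a b}, (vStructures G.skel S).head a b → M.head a b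
  forced : ∀ {a b}, M.head a b → Forced S G.skel a b

theorem OrientInv.vStructures (h : SepInfo S G) : OrientInv G S (vStructures G.skel S) where
  sep := h
  skel := rfl
  vStructure := id
  forced := fun ⟨h1, _, _, h2, h3, h4⟩ => .vStructure h1 h2 h3 h4

theorem OrientInv.rule (h : OrientInv G S M) {a b : V} (hr : RuleApplies S M a b) :
    OrientInv G S (addHead M a b hr.adj) where
  sep := h.sep
  skel := h.skel
  vStructure hab := .inl (h.vStructure hab)
  forced {x y} hxy := by
    rcases hxy with hxy | ⟨rfl, rfl⟩
    · exact h.forced hxy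
    · cases hr with
      | rule1 u _ _ T h1 h2 _ _ _ h6 h7 => exact .rule1 (h.forced h1) (h.skel ▸ h2) h6 h7
      | rule2 _ u _ h1 h2 h3 => exact .rule2 (h.forced h1) (h.forced h2) (h.skel ▸ h3)
      | rule3 u v _ _ T h1 h2 _ _ h5 h6 h7 h8 h9 =>
        exact .rule3 (h.forced h1) (h.forced h2) (h.skel ▸ h5) (h.skel ▸ h6) (h.skel ▸ h7) h8 h9

theorem OrientInv.isEssential (hG : G.IsMVRChainGraph) (h : OrientInv G S M)
    (hc : ∀ a b, RuleApplies S M a b → M.head a b) : IsEssential S G M := by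
  refine ⟨hG, h.sep, h.skel, fun a b => ⟨h.forced, fun hab => ?_⟩⟩
  induction hab with
  | vStructure h1 h2 h3 h4 => exact h.vStructure ⟨h1, _, _, h2, h3, h4⟩
  | @rule1 u a b T hu hab hT ha ih =>
    -- The side condition of rule 1 is automatic: an arrowhead at `a` from `b` would make `a` a
    -- collider, contrary to `a ∈ T`.
    refine hc _ _ (.rule1 u a b T ih (h.skel ▸ hab) (fun hba => ?_) (h.sep.ne hT)
      (h.skel ▸ h.sep.not_adj hT) hT ha)
    exact (h.sep.notMem_iff hG hT hu.adj hab).2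
      ⟨hu.head h.sep hG, (h.forced hba).head h.sep hG⟩ ha
  | rule2 h1 h2 h3 ih1 ih2 => exact hc _ _ (.rule2 _ _ _ ih1 ih2 (h.skel ▸ h3))
  | rule3 h1 h2 h3 h4 h5 h6 h7 ih1 ih2 =>
    exact hc _ _ (.rule3 _ _ _ _ _ ih1 ih2 (h.sep.ne h6) (h.skel ▸ h.sep.not_adj h6)
      (h.skel ▸ h3) (h.skel ▸ h4) (h.skel ▸ h5) h6 h7)

/-- The invariant of the algorithm. -/
def Inv (G : MixedGraph V) : State V → Prop
  | .skeleton i A H S => SkelInv G i A H S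
  | .orient S M => OrientInv G S M
  | .done G' => IsCorrectOutput G G'

variable [Fintype V]

theorem Inv.step (hG : G.IsMVRChainGraph) (ht : IsPerfectTest G test) {s t : State V}
    (hs : Inv G s) (hst : Step test s t) : Inv G t := by
  cases hst with
  | remove i A H S u v T _ hc => exact SkelInv.remove hG ht hs hc
  | nextLevel i A H S _ hn => exact SkelInv.nextLevel ht hs hn
  | vStructure i A H S hi =>
    obtain rfl := SkelInv.eq_skel hG hs hi
    exact .vStructures (SkelInv.sepInfo hs)
  | rule S M a b hr _ => exact OrientInv.rule hs hr
  | finish S M T root rank pos hc hT hr hp =>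
    exact (OrientInv.isEssential hG hs hc).isCorrectOutput hT hr hp

theorem Inv.exists_step (hG : G.IsMVRChainGraph) {s : State V}
    (hs : Inv G s) (hd : ∀ G', s ≠ .done G') : ∃ t, Step test s t := by
  match s, hs, hd with
  | .skeleton i A H S, _, _ =>
    by_cases hi : i + 2 ≤ Fintype.card V
    · by_cases hc : ∃ u v T, CanRemove test i A H u v T
      · obtain ⟨u, v, T, hc⟩ := hc
        exact ⟨_, .remove i A H S u v T hi hc⟩
      · push Not at hc
        exact ⟨_, .nextLevel i A H S hi hc⟩
    · exact ⟨_, .vStructure i A H S hi⟩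
  | .orient S M, hs, _ =>
    by_cases hc : ∃ a b, RuleApplies S M a b ∧ ¬ M.head a b
    · obtain ⟨a, b, hr, hn⟩ := hc
      exact ⟨_, .rule S M a b hr hn⟩
    · push Not at hc
      obtain ⟨T, hT⟩ := (OrientInv.isEssential hG hs hc).exists_junctionTree
      obtain ⟨root⟩ := hT.1.1.nonempty
      obtain ⟨rank, hr⟩ := Finite.exists_injective_nat_of_lt fun C => T.dist root C
      obtain ⟨pos, hp⟩ := exists_isNodeOrder rank
      exact ⟨_, .finish S M T root rank pos hc hT hr hp⟩
  | .done G', _, hd => exact absurd rfl (hd G')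

/-! ### Termination and the main theorem -/

/-- A measure that decreases in every step of the algorithm. -/
noncomputable def stateMeasure : State V → ℕ
  | .skeleton i _ H _ =>
    Nat.card (V × V) + 2 + (Fintype.card V - i) + {p : V × V | H.Adj p.1 p.2}.ncard
  | .orient _ M => {p : V × V | ¬ M.head p.1 p.2}.ncard + 1
  | .done _ => 0

theorem Step.stateMeasure_lt {s t : State V} (h : Step test s t) :
    stateMeasure t < stateMeasure s := by
  cases h with
  | remove i A H S u v T _ hc =>
    refine Nat.add_lt_add_left (Set.ncard_lt_ncard ⟨fun p hp => ?_, fun hsub => ?_⟩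
      (Set.toFinite _)) _
    · exact (SimpleGraph.deleteEdges_adj.1 hp).1
    · have : (H.deleteEdges {s(u, v)}).Adj u v := hsub (a := (u, v)) hc.1
      simp [SimpleGraph.deleteEdges_adj] at this
  | nextLevel i A H S hi _ =>
    simp only [stateMeasure]
    omega
  -- The summand `Nat.card (V × V) + 2` exceeds every value of the measure in the orientation phase.
  | vStructure i A H S hi =>
    have := Set.ncard_le_card {p : V × V | ¬ (vStructures H S).head p.1 p.2}
    simp only [stateMeasure]
    omega
  | rule S M a b hr hn =>
    refine Nat.add_lt_add_right (Set.ncard_lt_ncard ⟨fun p hp => fun hp' => ?_, fun hsub => ?_⟩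
      (Set.toFinite _)) _
    · exact hp (Or.inl hp')
    · exact hsub (a := (a, b)) hn (.inr ⟨rfl, rfl⟩)
  | finish => exact Nat.succ_pos _

end StablePC

theorem theorem1 {V : Type*} [Fintype V] {E : V → Type*} [∀ v, MeasurableSpace (E v)]
    [∀ v, StandardBorelSpace (E v)] (p : Measure (∀ v, E v)) [IsProbabilityMeasure p]
    (G : MixedGraph V) (hG : G.IsMVRChainGraph) (hp : IsFaithful p G)
    (test : V → V → Finset V → Prop)
    (htest : ∀ (u v : V) (T : Finset V), u ≠ v → u ∉ T → v ∉ T →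
      (test u v T ↔ CondIndepVars p {u} {v} T)) :
    (¬ ∃ s : ℕ → StablePC.State V, s 0 = StablePC.init ∧
      ∀ k, StablePC.Step test (s k) (s (k + 1))) ∧
    ∀ s : StablePC.State V, Relation.ReflTransGen (StablePC.Step test) StablePC.init s →
      (∀ t, ¬ StablePC.Step test s t) →
      ∃ G' : MixedGraph V, s = .done G' ∧ G'.IsMVRChainGraph ∧ G'.MarkovEquivalent G ∧
        ∀ K : MixedGraph V, K.IsMVRChainGraph → K.MarkovEquivalent G →
          ∀ a b, G'.Bi a b → K.Bi a b := by
  have ht : StablePC.IsPerfectTest G test := fun u v T huv hu hv =>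
    (htest u v T huv hu hv).trans
      (hp _ _ _ (MixedGraph.admissibleTriple_singleton huv hu hv))
  constructor
  · rintro ⟨s, -, hs⟩
    have key : ∀ k, StablePC.stateMeasure (s k) + k ≤ StablePC.stateMeasure (s 0) := by
      intro k
      induction k with
      | zero => exact le_rfl
      | succ k ih =>
        have := (hs k).stateMeasure_lt
        omega
    have := key (StablePC.stateMeasure (s 0) + 1)
    omega
  · intro s hs hterm
    have hinv : StablePC.Inv G s := by
      clear hterm
      induction hs with
      | refl => exact StablePC.SkelInv.init G
      | tail _ hst ih => exact ih.step hG ht hst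
    by_cases hd : ∃ G', s = .done G'
    · obtain ⟨G', rfl⟩ := hd
      exact ⟨G', rfl, hinv⟩
    · push Not at hd
      obtain ⟨t, hst⟩ := hinv.exists_step (test := test) hG hd
      exact absurd hst (hterm t)
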